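/- **Lattice.** Let $L,T\ge 1$. Consider the cubic lattice $L\times L\times[0,T]$, periodic in the two space directions and with boundary at times $0$ and $T$. Let $C^k$ be the space of $\mathbb Z_2$-valued $k$-chains, $d:C^k\to C^{k+1}$ the coboundary (adjacency matrix mod 2), $d^T$ its transpose, $\langle\cdot,\cdot\rangle$ the standard inner product, and $\epsilon$ the chain equal to $1$ on all top-dimensional cells. The cup product on a cubical cell is the sum, over sequential collections of subcells leading from the corner $(0,0,\dots)$ to the corner $(1,1,\dots)$, of the products of the values. We use triples of chains $a=(a_{\tt r},a_{\tt g},a_{\tt b})$ and apply $d,d^T,\langle\cdot,\cdot\rangle$ colourwise. For a spatial cell $\sigma$ write $t\sigma$ for its copy at time $t$, and $t^+\sigma$ for $\sigma\times[t,t+1]$. **Circuit.** Let $V,E,F$ be the vertices, edges and faces of the periodic $L\times L$ square lattice, with one qubit per colour and edge. Let $B_{\lambda f}=\prod_{e\in f}Z_{\lambda e}$, and $$A_{{\tt r}v}|a\rangle=(-1)^{\langle\epsilon,v\cup a_{\tt g}\cup a_{\tt b}\rangle}|a+d({\tt r},v)\rangle,\quad A_{{\tt g}v}|a\rangle=(-1)^{\langle\epsilon,a_{\tt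 r}\cup v\cup a_{\tt b}\rangle}|a+d({\tt g},v)\rangle,\quad A_{{\tt b}v}|a\rangle=(-1)^{\langle\epsilon,a_{\tt r}\cup a_{\tt g}\cup v\rangle}|a+d({\tt b},v)\rangle .$$ Put $\Pi^s_{\lambda v}=\frac12(1+(-1)^sA_{\lambda v})$ and $\Gamma^s_{\lambda f}=\frac12(1+(-1)^sB_{\lambda f})$. For a triple $b$ of 2-chains (flux) and a triple $c$ of 1-chains (charge) the TQD circuit is $$C_{b,c}=\prod_{0\le t<T}\ \prod_{\lambda={\tt r},{\tt g},{\tt b}}\Big(\prod_{v\in V}\Pi_{\lambda v}^{c_{\lambda t^+v}}\prod_{e\in E}X_{\lambda e}^{b_{\lambda t^+e}}Z_{\lambda e}^{c_{\lambda te}}\prod_{f\in F}\Gamma_{\lambda f}^{b_{\lambda tf}}\Big),$$ with later rounds to the left and the colours in the written order (blue acts first). The values of $b$ and $c$ at time $T$ do not enter. The values $b_{\lambda Tf}$ are fixed to be the outgoing flux, that is, $db=0$ on the cubes of the last time step $[T-1,T]$. **Twisted data.** Let $2S[a]=\langle\epsilon,a_{\tt r}\cup a_{\tt g}\cup a_{\tt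 b}\rangle\in\mathbb Z_2$ and $\Delta S[a,v]=S[a+dv]-S[a]$. For triples $x$ of 1-chains and $v$ of 0-chains define $\widetilde M^bv$ by $$\langle x,\widetilde M^bv\rangle=\langle\epsilon,\ x_{\tt r}\cup b_{\tt g}\cup v_{\tt b}+b_{\tt r}\cup x_{\tt g}\cup v_{\tt b}+x_{\tt r}\cup v_{\tt g}\cup b_{\tt b}+b_{\tt r}\cup v_{\tt g}\cup x_{\tt b}+v_{\tt r}\cup x_{\tt g}\cup b_{\tt b}+v_{\tt r}\cup b_{\tt g}\cup x_{\tt b}\rangle$$ and $M^b$ by replacing $x$ with $dw$: $\langle w,M^bv\rangle=\langle dw,\widetilde M^bv\rangle$. Call $v$ *interior* if it vanishes on the vertices at times $0$ and $T$. Let $K^b$ be any $\mathbb Z_2$-matrix, with rows indexed by a finite set $I$, such that $(K^b)^T$ is injective with image $\{v\text{ interior}: M^bv=0\}$. For $a$ with $da=b$ put $\kappa^b_i=2\Delta S[a,(K^b)^Ti]$ for $i\in I$. Say that an edge $e$ is *next to* $b$ if there are a cube and a face $f$ of it carrying flux of some colour such that $(e,f)$ or $(f,e)$ is a sequential pair of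 that cube. Say that $b$ *contains no non-contractible loop* if every closed lattice path along edges next to $b$ is contractible in the lattice, i.e. lifts to a closed path in the universal cover. **Claims.** For all such $b$ and all $c$: 1. (Flux constraint) If $db\ne0$, then $C_{b,c}=0$. 2. (The form $M^b$) If $da=b$ and $v$ is interior, then $2\Delta S[a+dw,v]-2\Delta S[a,v]=\langle w,M^bv\rangle$ for all $w$. If $db=0$, then $M^b$ is a symmetric form on interior $v,w$. Moreover $d^T\widetilde M^b=M^b$. 3. (Twisted constraint) Suppose $b$ contains no non-contractible loop. Then $\kappa^b$ does not depend on the choice of $a$ with $da=b$. For every such $a$, $2\Delta S[a,(K^b)^Ty]=\langle\kappa^b,y\rangle$ for all $y\in\mathbb Z_2^I$, and $$K^bd^Tc\ne\kappa^b\ \Rightarrow\ C_{b,c}=0 .$$ 4. (Twisted equivalence) For all triples $\gamma$ of 2-chains and all interior $v$, put $\delta=d^T\gamma+\widetilde M^bv$. There is a sign $s\in\{1,-1\}$ with $$C_{b,c+\delta}=s\Big(\prod_{\lambda,e}Z_{\lambda e}^{\delta_{\lambda Te}}\Big)C_{b,c}.$$ In particular $C_{b,\,c+d^T\gamma+\widetilde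 M^bv}=s\,C_{b,c}$ whenever $\delta$ vanishes on the edges at the final time $T$ (where the circuit has no error location). -/

import Mathlib

open scoped Matrix

noncomputable section

set_option linter.unusedSectionVars false

namespace TQD

/-! ### The spacetime lattice and its cellular cohomology -/

/-- The three colours: red, green, blue. -/
inductive Color
  | r | g | b
  deriving DecidableEq

instance : Fintype Color := ⟨{.r, .g, .b}, fun x => by cases x <;> decide⟩

/-- The elementary lattice step in direction `i` (0 and 1 are the space directions, 2 is time). -/
def step (R : Type) [Ring R] (i : Fin 3) : R × R × ℕ := ![(1, 0, 0), (0, 1, 0), (0, 0, 1)] i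

/-- The vertex reached from `p` by one step in each of the directions of `S`. -/
def shift {L : ℕ} (p : ZMod L × ZMod L × ℕ) (S : Finset (Fin 3)) : ZMod L × ZMod L × ℕ :=
  p + ∑ i ∈ S, step (ZMod L) i

/-- The `k`-cells of the cubic lattice `L × L × [0, T]`, periodic in the two space directions and
with boundary at the times `0` and `T`. A cell is given by its corner with the smallest coordinates
and by the set of the `k` directions in which it extends; a cell that extends in the time
direction must start at a time `< T`. For `T = 0` this is the periodic `L × L` square lattice. -/
abbrev Cell (L T k : ℕ) : Type :=
  {x : (ZMod L × ZMod L × Fin (T + 1)) × Finset (Fin 3) //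
    x.2.card = k ∧ (2 ∈ x.2 → (x.1.2.2 : ℕ) < T)}

/-- The corner `(0,0,…)` of a cell. -/
def Cell.pos {L T k : ℕ} (x : Cell L T k) : ZMod L × ZMod L × ℕ :=
  (x.1.1.1, x.1.1.2.1, (x.1.1.2.2 : ℕ))

/-- The directions in which a cell extends. -/
def Cell.axes {L T k : ℕ} (x : Cell L T k) : Finset (Fin 3) := x.1.2

/-- The (starting) time of a cell. -/
def Cell.time {L T k : ℕ} (x : Cell L T k) : ℕ := (x.1.1.2.2 : ℕ)

/-- `ℤ₂`-valued `k`-chains. -/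
abbrev Chain (L T k : ℕ) : Type := Cell L T k → ZMod 2

/-- Triples of `k`-chains, one for each colour. -/
abbrev CChain (L T k : ℕ) : Type := Color × Cell L T k → ZMod 2

/-- The component of a triple of chains with a given colour. -/
def CChain.comp {L T k : ℕ} (a : CChain L T k) (c : Color) : Chain L T k := fun x => a (c, x)

/-- The adjacency matrix between `k`-cells and `(k+1)`-cells: the faces of the cell with corner `p`
and directions `S` are, for each `i ∈ S`, the cells with directions `S \ {i}` at `p` and at `p`
shifted by one step in direction `i`. -/
def dMat (L T k : ℕ) : Matrix (Cell L T (k + 1)) (Cell L T k) (ZMod 2) := fun x y =>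
  ∑ i ∈ x.axes,
    ((if y.pos = x.pos ∧ y.axes = x.axes.erase i then 1 else 0) +
      (if y.pos = shift x.pos {i} ∧ y.axes = x.axes.erase i then 1 else 0))

variable {L T : ℕ} [NeZero L]

/-- The coboundary `d a` of a triple of chains. -/
def d {k : ℕ} (a : CChain L T k) : CChain L T (k + 1) :=
  fun x => (dMat L T k *ᵥ a.comp x.1) x.2

/-- The boundary `dᵀ c` of a triple of chains. -/
def dT {k : ℕ} (c : CChain L T (k + 1)) : CChain L T k :=
  fun y => ((dMat L T k)ᵀ *ᵥ c.comp y.1) y.2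

/-- The value of a chain on the cell with corner `p` and directions `S`; it is `0` if this is not
a `k`-cell of the lattice. -/
def Chain.val {k : ℕ} (a : Chain L T k) (p : ZMod L × ZMod L × ℕ) (S : Finset (Fin 3)) : ZMod 2 :=
  if h : p.2.2 < T + 1 ∧ S.card = k ∧ (2 ∈ S → p.2.2 < T) then
    a ⟨((p.1, p.2.1, ⟨p.2.2, h.1⟩), S), h.2⟩ else 0

/-- The cup product: the sum over all sequential pairs of subcells. The first one starts
at the `(0,0,…)` corner and extends in the directions `U`, the second one starts where the first
one ends, and extends in the remaining directions. -/
def cup {i j : ℕ} (a : Chain L T i) (b : Chain L T j) : Chain L T (i + j) := fun x =>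
  ∑ U ∈ x.axes.powerset, a.val x.pos U * b.val (shift x.pos U) (x.axes \ U)

/-- `⟨ε, a ∪ b ∪ c⟩`, the sum of the cup product over all cells. -/
def cupSum {i j k : ℕ} (a : Chain L T i) (b : Chain L T j) (c : Chain L T k) : ZMod 2 :=
  ∑ x, cup (cup a b) c x

/-! ### The circuit -/

/-- The cell `tσ` at time `t` over a cell `σ` of the square lattice. -/
def atTime {k : ℕ} (t : Fin (T + 1)) (s : Cell L 0 k) : Cell L T k :=
  ⟨((s.1.1.1, s.1.1.2.1, t), s.1.2), s.2.1, fun h => absurd (s.2.2 h) (Nat.not_lt_zero _)⟩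

/-- The cell `t⁺σ` with time coordinate `[t, t+1]` over a cell `σ` of the square lattice. -/
def overTime {k : ℕ} (t : Fin T) (s : Cell L 0 k) : Cell L T (k + 1) :=
  ⟨((s.1.1.1, s.1.1.2.1, t.castSucc), insert 2 s.1.2), by
    refine ⟨?_, fun _ => t.2⟩
    rw [Finset.card_insert_of_notMem (fun h => absurd (s.2.2 h) (Nat.not_lt_zero _)), s.2.1]⟩

/-- The computational basis: one bit for each colour and each edge of the square lattice. -/
abbrev Config (L : ℕ) : Type := CChain L 0 1

/-- Linear operators on the space of all qubits. A state is the family of its amplitudes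
in the computational basis. -/
abbrev Op (L : ℕ) : Type := Module.End ℂ (Config L → ℂ)

/-- `(-1)^s`. -/
def sgn (s : ZMod 2) : ℂ := if s = 0 then 1 else -1

/-- The diagonal operator `|g⟩ ↦ f(g) |g⟩`. -/
def diagOp (f : Config L → ℂ) : Op L where
  toFun ψ := fun g => f g * ψ g
  map_add' ψ φ := by ext g; simp [mul_add]
  map_smul' z ψ := by ext g; simp [mul_left_comm]

/-- The operator `|g⟩ ↦ |g + h⟩`. -/
def shiftOp (h : Config L) : Op L where
  toFun ψ := fun g => ψ (g - h)
  map_add' _ _ := rfl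
  map_smul' _ _ := rfl

/-- Pauli-`X` on the qubit of colour `c` on the edge `e`. -/
def X (c : Color) (e : Cell L 0 1) : Op L := shiftOp (Pi.single (c, e) 1)

/-- Pauli-`Z` on the qubit of colour `c` on the edge `e`. -/
def Z (c : Color) (e : Cell L 0 1) : Op L := diagOp fun g => sgn (g (c, e))

/-- The plaquette stabilizer, the product of the `Z` operators on the edges of the face `f`. -/
def B (c : Color) (f : Cell L 0 2) : Op L :=
  diagOp fun g => ∏ e with dMat L 0 1 f e = 1, sgn (g (c, e))

/-- The phase exponent of the vertex stabilizer in the basis state `a`. -/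
def vertexPhase (c : Color) (v : Cell L 0 0) (a : Config L) : ZMod 2 :=
  let δ : Chain L 0 0 := Pi.single v 1
  match c with
  | .r => cupSum δ (a.comp .g) (a.comp .b)
  | .g => cupSum (a.comp .r) δ (a.comp .b)
  | .b => cupSum (a.comp .r) (a.comp .g) δ

/-- The Clifford vertex stabilizer, e.g. for red
`A_{r v} |a⟩ = (-1)^⟨ε, v ∪ a_g ∪ a_b⟩ |a + d(r, v)⟩`. -/
def A (c : Color) (v : Cell L 0 0) : Op L :=
  shiftOp (d (Pi.single (c, v) 1)) * diagOp fun a => sgn (vertexPhase c v a)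

/-- The projector `½ (1 + (-1)^s A)` onto an outcome of a vertex measurement. -/
def projA (c : Color) (v : Cell L 0 0) (s : ZMod 2) : Op L :=
  (1 / 2 : ℂ) • (1 + sgn s • A c v)

/-- The projector `½ (1 + (-1)^s B)` onto an outcome of a plaquette measurement. -/
def projB (c : Color) (f : Cell L 0 2) (s : ZMod 2) : Op L :=
  (1 / 2 : ℂ) • (1 + sgn s • B c f)

lemma diagOp_commute (f g : Config L → ℂ) : Commute (diagOp f) (diagOp g) := by
  refine LinearMap.ext fun ψ => funext fun x => ?_
  simp [diagOp, mul_left_comm]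

lemma shiftOp_commute (h k : Config L) : Commute (shiftOp h) (shiftOp k) := by
  refine LinearMap.ext fun ψ => funext fun x => ?_
  simp [shiftOp, sub_right_comm]

/-- The phase of a vertex stabilizer does not see the colour of the stabilizer. -/
lemma vertexPhase_sub (c : Color) (v w : Cell L 0 0) (a : Config L) :
    vertexPhase c v (a - d (Pi.single (c, w) 1)) = vertexPhase c v a := by
  have key : ∀ c' : Color, c' ≠ c →
      CChain.comp (a - d (Pi.single (c, w) 1)) c' = CChain.comp a c' := by
    intro c' hc
    funext x
    have : CChain.comp (Pi.single (c, w) 1 : CChain L 0 0) c' = 0 := by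
      funext y
      simp [CChain.comp, hc]
    simp [CChain.comp, d]
    change (dMat L 0 0 *ᵥ CChain.comp (Pi.single (c, w) 1 : CChain L 0 0) c') x = 0
    rw [this, Matrix.mulVec_zero]
    rfl
  cases c <;> simp [vertexPhase, key]

lemma shiftOp_mul_diagOp_commute (h k : Config L) (f g : Config L → ℂ)
    (hf : ∀ a, f (a - k) = f a) (hg : ∀ a, g (a - h) = g a) :
    Commute (shiftOp h * diagOp f) (shiftOp k * diagOp g) := by
  refine LinearMap.ext fun ψ => funext fun x => ?_
  change f (x - h) * (g (x - h - k) * ψ (x - h - k)) = g (x - k) * (f (x - k - h) * ψ (x - k - h))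
  rw [sub_right_comm x k h, hf, sub_right_comm x h k, hg, mul_left_comm]

lemma A_commute (c : Color) (v w : Cell L 0 0) : Commute (A c v) (A c w) :=
  shiftOp_mul_diagOp_commute _ _ _ _
    (fun a => congrArg sgn (vertexPhase_sub c v w a))
    (fun a => congrArg sgn (vertexPhase_sub c w v a))

lemma projA_commute (c : Color) (v w : Cell L 0 0) (s t : ZMod 2) :
    Commute (projA c v s) (projA c w t) :=
  (((Commute.one_left _).add_left (((Commute.one_right _).add_right
    ((A_commute c v w).smul_right _)).smul_left _)).smul_left _).smul_right _

lemma projB_commute (c : Color) (v w : Cell L 0 2) (s t : ZMod 2) :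
    Commute (projB c v s) (projB c w t) :=
  (((Commute.one_left _).add_left (((Commute.one_right _).add_right
    ((diagOp_commute _ _).smul_right _)).smul_left _)).smul_left _).smul_right _

lemma XZ_commute (c : Color) (e f : Cell L 0 1) (h : e ≠ f) : Commute (X c e) (Z c f) := by
  refine LinearMap.ext fun ψ => funext fun x => ?_
  simp [X, Z, shiftOp, diagOp, h.symm]

lemma XZ_pow_commute (c : Color) (e f : Cell L 0 1) (h : e ≠ f) (k l m n : ℕ) :
    Commute (X c e ^ k * Z c e ^ l) (X c f ^ m * Z c f ^ n) :=
  Commute.mul_left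
    (((shiftOp_commute _ _).pow_pow k m).mul_right ((XZ_commute c e f h).pow_pow k n))
    (((XZ_commute c f e h.symm).symm.pow_pow l m).mul_right ((diagOp_commute _ _).pow_pow l n))

/-- The operations for the colour `c` in round `t`: first the plaquette measurements, then the
Pauli operators, then the vertex measurements. -/
def colorStep (b : CChain L T 2) (q : CChain L T 1) (t : Fin T) (c : Color) : Op L :=
  Finset.univ.noncommProd (fun v : Cell L 0 0 => projA c v (q (c, overTime t v)))
      (fun _ _ _ _ _ => projA_commute _ _ _ _ _) *
    Finset.univ.noncommProd
      (fun e : Cell L 0 1 =>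
        X c e ^ (b (c, overTime t e)).val * Z c e ^ (q (c, atTime t.castSucc e)).val)
      (fun _ _ _ _ h => XZ_pow_commute _ _ _ h _ _ _ _) *
    Finset.univ.noncommProd (fun f : Cell L 0 2 => projB c f (b (c, atTime t.castSucc f)))
      (fun _ _ _ _ _ => projB_commute _ _ _ _ _)

/-- One round of the circuit: blue acts first, then green, then red. -/
def round (b : CChain L T 2) (q : CChain L T 1) (t : Fin T) : Op L :=
  colorStep b q t .r * colorStep b q t .g * colorStep b q t .b

/-- The operator `C_{b,q}` of the TQD circuit of `T` rounds with flux configuration `b` and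
charge configuration `q`. Later rounds stand on the left. The values of `b` on faces at
time `T` and of `q` on edges at time `T` do not enter. -/
def circuit (b : CChain L T 2) (q : CChain L T 1) : Op L :=
  (List.ofFn (round b q)).reverse.prod

/-- The Pauli-`Z` string given by the values of `q` on the edges at the final time `T`. -/
def finalZ (q : CChain L T 1) : Op L :=
  diagOp fun g => ∏ ce : Color × Cell L 0 1, sgn (q (ce.1, atTime (Fin.last T) ce.2) * g ce)

/-! ### Gauge variance, twisted constraints and equivalences -/

/-- Twice the action, `2 S[a] = ⟨ε, a_r ∪ a_g ∪ a_b⟩` in `ℤ₂`. -/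
def action (a : CChain L T 1) : ZMod 2 := cupSum (a.comp .r) (a.comp .g) (a.comp .b)

/-- Twice the gauge variance, `2 ΔS[a, v] = 2 S[a + dv] - 2 S[a]`. -/
def gaugeVar (a : CChain L T 1) (v : CChain L T 0) : ZMod 2 := action (a + d v) - action a

/-- The space of triples of 0-chains (gauge transformations) that vanish on the
boundary vertices, at the times `0` and `T`. -/
def interior (L T : ℕ) : Submodule (ZMod 2) (CChain L T 0) where
  carrier := {v | ∀ c, ∀ x : Cell L T 0, x.time = 0 ∨ x.time = T → v (c, x) = 0}
  zero_mem' := fun _ _ _ => rfl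
  add_mem' := fun hv hw c x hx => by simp [hv c x hx, hw c x hx]
  smul_mem' := fun z v hv c x hx => by simp [hv c x hx]

/-- The trilinear form `⟨x, M̃^b v⟩`. -/
def twistForm (b : CChain L T 2) (x : CChain L T 1) (v : CChain L T 0) : ZMod 2 :=
  cupSum (x.comp .r) (b.comp .g) (v.comp .b) + cupSum (b.comp .r) (x.comp .g) (v.comp .b) +
  cupSum (x.comp .r) (v.comp .g) (b.comp .b) + cupSum (b.comp .r) (v.comp .g) (x.comp .b) +
  cupSum (v.comp .r) (x.comp .g) (b.comp .b) + cupSum (v.comp .r) (b.comp .g) (x.comp .b)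

/-- The twisted errors `M̃^b v`: the triple of 1-chains with `⟨x, M̃^b v⟩ = twistForm b x v`. -/
def twist (b : CChain L T 2) (v : CChain L T 0) : CChain L T 1 :=
  fun e => twistForm b (Pi.single e 1) v

/-- `M^b v`: the triple of 0-chains with `⟨w, M^b v⟩ = twistForm b (dw) v`. -/
def M (b : CChain L T 2) (v : CChain L T 0) : CChain L T 0 :=
  fun y => twistForm b (d (Pi.single y 1)) v

/-- `Kᵀ` is an injective matrix whose image is the kernel of `M^b`. -/
def IsConstraintMatrix {I : Type} [Fintype I] (b : CChain L T 2)
    (K : Matrix I (Color × Cell L T 0) (ZMod 2)) : Prop :=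
  Function.Injective (fun y => Kᵀ *ᵥ y) ∧
    Set.range (fun y => Kᵀ *ᵥ y) = {v | v ∈ interior L T ∧ M b v = 0}

/-- The vector `κ^b` computed from a 1-chain `a` with `da = b`. -/
def kappa {I : Type} [Fintype I] [DecidableEq I] (a : CChain L T 1)
    (K : Matrix I (Color × Cell L T 0) (ZMod 2)) : I → ZMod 2 :=
  fun x => gaugeVar a (Kᵀ *ᵥ Pi.single x 1)

/-! ### Non-contractible flux loops -/

/-- An edge `e` is next to the flux if there are a face `f` carrying flux of some colour and a cube
in which `(e, f)` or `(f, e)` is sequential. (The dual edge of `f` is moved onto the lattice by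
half a lattice constant in each direction, forwards or backwards.) -/
def NextToFlux (b : CChain L T 2) (e : Cell L T 1) : Prop :=
  ∃ (c : Color) (f : Cell L T 2) (x : Cell L T 3), b (c, f) ≠ 0 ∧ e.axes ∩ f.axes = ∅ ∧
    ((e.pos = x.pos ∧ f.pos = shift x.pos e.axes) ∨
      (f.pos = x.pos ∧ e.pos = shift x.pos f.axes))

/-- The covering map from the universal cover `ℤ × ℤ × [0, T]`. -/
def proj (L : ℕ) (p : ℤ × ℤ × ℕ) : ZMod L × ZMod L × ℕ := ((p.1 : ZMod L), (p.2.1 : ZMod L), p.2.2)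

/-- Two vertices of the universal cover that are the endpoints of a lift of an edge next to the
flux. -/
def FluxAdj (b : CChain L T 2) (p q : ℤ × ℤ × ℕ) : Prop :=
  ∃ (e : Cell L T 1) (i : Fin 3), NextToFlux b e ∧ e.axes = {i} ∧ proj L p = e.pos ∧
    q = p + step ℤ i

/-- `b` contains no non-contractible loops: every closed lattice path along edges next to
the flux lifts to a closed path in the universal cover. -/
def NoNoncontractibleLoop (b : CChain L T 2) : Prop :=
  ∀ p q : ℤ × ℤ × ℕ, Relation.EqvGen (FluxAdj b) p q → proj L p = proj L q → p = q

end TQD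

end

/-!
The circuit is a discretized path integral. Expanding every vertex projector into gauge
transformations turns the amplitude of the circuit into a sum over histories: triples `a` of
1-chains of the spacetime lattice, whose spatial edges carry the configurations at the successive
times and whose time-like edges carry the gauge transformations. The plaquette projectors and the
Pauli-`X` operators restrict the sum to `da = b`. The phases of the vertex stabilizers, taken in
the order blue, green, red, add up to the cup product action `2S[a]`, because a triple product of
1-chains on a prism `[t, t+1] × face` evaluates the factors before the time-like edge at time `t`
and those after it at time `t + 1`. The charges contribute `⟨q, a⟩`, except for the edges at
the final time, which the circuit does not read. This is `circuit_apply`.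

If `db ≠ 0`, there is no history at all, since `dda = 0`. The other claims about the circuit follow
from the substitution `a ↦ a + dv` with an interior gauge transformation `v` (`pathSum_gauge`). It
changes the exponent by `⟨v, dᵀq⟩ + 2ΔS[a, v]`. By the
Leibniz rule `coboundary_mul`, associativity of the cup product, and Stokes' theorem
`integral_coboundary`, `2ΔS[a, v] = ⟨a, M̃ᵇ v⟩ + const(b, v)` for all `a` with `da = b`
(`gaugeVar_eq`); the six terms of the twisted form are the terms of first order in `v`, integrated
by parts. This gives the twisted equivalences at once. It also gives the form `Mᵇ` as the
second-order gauge variance, and for `Mᵇ v = 0` it makes `2ΔS[a, v]` invariant under `a ↦ a + dw`.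

To compare two histories with the same flux that differ by a cocycle `x` which is not a coboundary,
one uses that there are no non-contractible flux loops: the lattice can then be lifted to
its universal cover compatibly with the edges next to the flux
(`NoNoncontractibleLoop.exists_section`), so a primitive of the lift of `x` yields `w` for
which `x + dw` vanishes on these edges, and with it every term of the twisted form. Hence
`2ΔS[a, v]` depends only on `b`, and if it differs from `⟨v, dᵀq⟩` the amplitudes of `a` and
`a + dv` cancel.
-/

noncomputable section

set_option linter.unusedSectionVars false

namespace TQD

variable {L T : ℕ} [NeZero L]

/-! ### The differential graded algebra of cochains -/

/-- The cell with corner `p` and directions `S` lies in the lattice `L × L × [0, T]`. -/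
def InLattice (T : ℕ) (p : ZMod L × ZMod L × ℕ) (S : Finset (Fin 3)) : Prop :=
  p.2.2 < T + 1 ∧ (2 ∈ S → p.2.2 < T)

instance (p : ZMod L × ZMod L × ℕ) (S : Finset (Fin 3)) : Decidable (InLattice T p S) := by
  unfold InLattice; infer_instance

lemma shift_empty (p : ZMod L × ZMod L × ℕ) : shift p ∅ = p := by simp [shift]

lemma shift_shift (p : ZMod L × ZMod L × ℕ) {S U : Finset (Fin 3)} (h : Disjoint S U) :
    shift (shift p S) U = shift p (S ∪ U) := by
  simp [shift, Finset.sum_union h, add_assoc]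

lemma shift_time (p : ZMod L × ZMod L × ℕ) (S : Finset (Fin 3)) :
    (shift p S).2.2 = p.2.2 + if 2 ∈ S then 1 else 0 := by
  have h : ∀ i : Fin 3, (step (ZMod L) i).2.2 = if 2 = i then 1 else 0 := by
    intro i; fin_cases i <;> simp [step]
  simp [shift, Prod.snd_sum, h]

lemma InLattice.face {p : ZMod L × ZMod L × ℕ} {S : Finset (Fin 3)} (h : InLattice T p S)
    (i : Fin 3) : InLattice T p (S.erase i) := by
  unfold InLattice at *
  exact ⟨h.1, fun h2 => h.2 (Finset.mem_of_mem_erase h2)⟩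

lemma InLattice.shift_face {p : ZMod L × ZMod L × ℕ} {S : Finset (Fin 3)} (h : InLattice T p S)
    {i : Fin 3} (hi : i ∈ S) : InLattice T (shift p {i}) (S.erase i) := by
  unfold InLattice at *
  rw [shift_time]
  by_cases h2 : 2 = i
  · subst h2; simp [h.2 hi]
  · simp only [Finset.mem_singleton, h2, if_false, add_zero]
    exact ⟨h.1, fun h2 => h.2 (Finset.mem_of_mem_erase h2)⟩

/-- Cochains of mixed degree on the lattice, as functions of the corner and of the directions of a
cell, extended by zero to the pairs that are not cells of the lattice. Allowing all degrees at once
avoids identifying the types of `i + (j + k)`- and `(i + j) + k`-cochains. -/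
def cochains (L T : ℕ) : AddSubgroup ((ZMod L × ZMod L × ℕ) → Finset (Fin 3) → ZMod 2) where
  carrier := {f | ∀ p S, ¬ InLattice T p S → f p S = 0}
  zero_mem' := fun _ _ _ => rfl
  add_mem' := fun hf hg p S h => by simp [hf p S h, hg p S h]
  neg_mem' := fun hf p S h => by simp [hf p S h]

/-- The type of cochains of mixed degree on the lattice. -/
abbrev Cochain (L T : ℕ) : Type := cochains L T

namespace Cochain

@[ext] lemma ext {f g : Cochain L T} (h : ∀ p S, InLattice T p S → f.1 p S = g.1 p S) : f = g := by
  refine Subtype.ext (funext fun p => funext fun S => ?_)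
  by_cases hp : InLattice T p S
  · exact h p S hp
  · rw [f.2 p S hp, g.2 p S hp]

/-- The cup product. It vanishes off the lattice because a cell that starts too late has one
subcell of each sequential pair that starts too late. -/
instance : Mul (Cochain L T) where
  mul f g := ⟨fun p S => ∑ U ∈ S.powerset, f.1 p U * g.1 (shift p U) (S \ U), by
    refine fun p S h => Finset.sum_eq_zero fun U hU => ?_
    by_cases h1 : InLattice T p U
    · rw [g.2 _ _ fun h2 => h ?_, mul_zero]
      have := shift_time p U
      unfold InLattice at *
      rw [this] at h2
      refine ⟨h1.1, fun hS => ?_⟩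
      by_cases h3 : 2 ∈ U
      · exact h1.2 h3
      · simp only [h3, if_false, add_zero, Finset.mem_sdiff, hS, not_false_eq_true, and_self,
          forall_const] at h2
        exact h2.2
    · rw [f.2 p U h1, zero_mul]⟩

lemma mul_apply (f g : Cochain L T) (p : ZMod L × ZMod L × ℕ) (S : Finset (Fin 3)) :
    (f * g).1 p S = ∑ U ∈ S.powerset, f.1 p U * g.1 (shift p U) (S \ U) := rfl

@[simp] lemma add_apply (f g : Cochain L T) (p : ZMod L × ZMod L × ℕ) (S : Finset (Fin 3)) :
    (f + g).1 p S = f.1 p S + g.1 p S := rfl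

@[simp] lemma zero_apply (p : ZMod L × ZMod L × ℕ) (S : Finset (Fin 3)) :
    (0 : Cochain L T).1 p S = 0 := rfl

protected lemma mul_assoc (f g h : Cochain L T) : f * g * h = f * (g * h) := by
  ext p S -
  simp only [mul_apply, Finset.sum_mul, Finset.mul_sum]
  rw [Finset.sum_sigma', Finset.sum_sigma']
  refine Finset.sum_bij' (fun x _ => ⟨x.2, x.1 \ x.2⟩) (fun x _ => ⟨x.1 ∪ x.2, x.1⟩) ?_ ?_ ?_ ?_ ?_
  · rintro ⟨U, W⟩ h
    simp only [Finset.mem_sigma, Finset.mem_powerset] at h ⊢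
    exact ⟨h.2.trans h.1, Finset.sdiff_subset_sdiff h.1 le_rfl⟩
  · rintro ⟨U, W⟩ h
    simp only [Finset.mem_sigma, Finset.mem_powerset] at h ⊢
    exact ⟨Finset.union_subset h.1 (h.2.trans Finset.sdiff_subset), Finset.subset_union_left⟩
  · rintro ⟨U, W⟩ h
    simp only [Finset.mem_sigma, Finset.mem_powerset] at h
    simp [Finset.union_sdiff_of_subset h.2]
  · rintro ⟨U, W⟩ h
    simp only [Finset.mem_sigma, Finset.mem_powerset] at h
    have : Disjoint U W := Finset.disjoint_of_subset_right h.2 Finset.disjoint_sdiff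
    simp [Finset.union_sdiff_cancel_left this]
  · rintro ⟨U, W⟩ h
    simp only [Finset.mem_sigma, Finset.mem_powerset] at h
    have h1 : (S \ W) \ (U \ W) = S \ U := by
      ext i; simp only [Finset.mem_sdiff]
      have := @h.2 i
      tauto
    simp only
    rw [shift_shift _ Finset.disjoint_sdiff, Finset.union_sdiff_of_subset h.2, h1, mul_assoc]

instance : NonUnitalRing (Cochain L T) where
  left_distrib f g h := by ext p S -; simp [mul_apply, mul_add, Finset.sum_add_distrib]
  right_distrib f g h := by ext p S -; simp [mul_apply, add_mul, Finset.sum_add_distrib]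
  zero_mul f := by ext p S -; simp [mul_apply]
  mul_zero f := by ext p S -; simp [mul_apply]
  mul_assoc := Cochain.mul_assoc

/-- The coboundary of cochains: the sum over the two faces in each direction of a cell. It is cut
off at the cells of the lattice, since the lower face of a non-cell at time `T` may be a cell. -/
def coboundary : Cochain L T →+ Cochain L T where
  toFun f := ⟨fun p S => if InLattice T p S then
      ∑ i ∈ S, (f.1 p (S.erase i) + f.1 (shift p {i}) (S.erase i)) else 0,
    fun _ _ h => if_neg h⟩
  map_zero' := by ext p S h; simp
  map_add' f g := by
    ext p S h
    simp only [add_apply, h, if_true, ← Finset.sum_add_distrib]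
    exact Finset.sum_congr rfl fun i _ => by ring

lemma coboundary_apply (f : Cochain L T) {p : ZMod L × ZMod L × ℕ} {S : Finset (Fin 3)}
    (h : InLattice T p S) :
    (coboundary f).1 p S = ∑ i ∈ S, (f.1 p (S.erase i) + f.1 (shift p {i}) (S.erase i)) :=
  if_pos h

/-- In a symmetric sum over pairs, the terms cancel in characteristic 2. -/
lemma sum_sum_erase_eq_zero (S : Finset (Fin 3)) (F : Fin 3 → Fin 3 → ZMod 2)
    (hF : ∀ i j, F i j = F j i) : ∑ i ∈ S, ∑ j ∈ S.erase i, F i j = 0 := by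
  rw [Finset.sum_sigma']
  refine Finset.sum_involution (fun x _ => ⟨x.2, x.1⟩) ?_ ?_ ?_ ?_
  · rintro ⟨i, j⟩ -
    simp only [hF j i]
    exact CharTwo.add_self_eq_zero _
  · rintro ⟨i, j⟩ h - h2
    simp only [Finset.mem_sigma, Finset.mem_erase] at h
    simp only [Sigma.mk.injEq] at h2
    exact h.2.1 h2.1
  · rintro ⟨i, j⟩ h
    simp only [Finset.mem_sigma, Finset.mem_erase] at h ⊢
    exact ⟨h.2.2, h.2.1.symm, h.1⟩
  · rintro ⟨i, j⟩ -
    rfl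

lemma coboundary_coboundary (f : Cochain L T) : coboundary (coboundary f) = 0 := by
  ext p S h
  rw [coboundary_apply _ h]
  have key : ∀ i ∈ S, (coboundary f).1 p (S.erase i) + (coboundary f).1 (shift p {i}) (S.erase i) =
      ∑ j ∈ S.erase i, (f.1 p ((S.erase i).erase j) + (f.1 (shift p {i}) ((S.erase i).erase j) +
        f.1 (shift p {j}) ((S.erase i).erase j)) +
        f.1 (p + step (ZMod L) i + step (ZMod L) j) ((S.erase i).erase j)) := by
    intro i hi
    rw [coboundary_apply _ (InLattice.face h i), coboundary_apply _ (InLattice.shift_face h hi),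
      ← Finset.sum_add_distrib]
    refine Finset.sum_congr rfl fun j _ => ?_
    simp only [shift, Finset.sum_singleton]
    ring
  rw [Finset.sum_congr rfl key]
  refine sum_sum_erase_eq_zero S _ fun i j => ?_
  rw [Finset.erase_right_comm (a := j), add_right_comm p (step _ i),
    add_comm (f.1 (shift p {i}) _)]

lemma sum_sdiff_comm (S : Finset (Fin 3)) (F : Fin 3 → Finset (Fin 3) → ZMod 2) :
    ∑ U ∈ S.powerset, ∑ i ∈ S \ U, F i U = ∑ i ∈ S, ∑ U ∈ (S.erase i).powerset, F i U := by
  refine Finset.sum_comm' fun U i => ?_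
  simp only [Finset.mem_powerset, Finset.mem_sdiff, Finset.subset_erase]
  tauto

/-- Summation over the sets `V` with a marked element `i`, in terms of `i` and `U = V \ {i}`. -/
lemma sum_erase_comm (S : Finset (Fin 3)) (F : Fin 3 → Finset (Fin 3) → ZMod 2) :
    ∑ U ∈ S.powerset, ∑ i ∈ U, F i (U.erase i) =
      ∑ i ∈ S, ∑ U ∈ (S.erase i).powerset, F i U := by
  rw [Finset.sum_sigma', Finset.sum_sigma']
  refine Finset.sum_bij' (fun x _ => ⟨x.2, x.1.erase x.2⟩) (fun x _ => ⟨insert x.1 x.2, x.1⟩)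
    ?_ ?_ ?_ ?_ ?_
  · rintro ⟨U, i⟩ h
    simp only [Finset.mem_sigma, Finset.mem_powerset] at h ⊢
    exact ⟨h.1 h.2, Finset.erase_subset_erase _ h.1⟩
  · rintro ⟨i, U⟩ h
    simp only [Finset.mem_sigma, Finset.mem_powerset, Finset.subset_erase] at h ⊢
    exact ⟨Finset.insert_subset h.1 h.2.1, Finset.mem_insert_self _ _⟩
  · rintro ⟨U, i⟩ h
    simp only [Finset.mem_sigma, Finset.mem_powerset] at h
    simp [Finset.insert_erase h.2]
  · rintro ⟨i, U⟩ h
    simp only [Finset.mem_sigma, Finset.mem_powerset, Finset.subset_erase] at h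
    simp [Finset.erase_insert h.2.2]
  · rintro ⟨U, i⟩ -
    rfl

/-- The Leibniz rule. The values on the cells `(p, U)` and `(p + U + i, S \ U \ i)` occur in both
terms on the right, and cancel. -/
lemma coboundary_mul (f g : Cochain L T) :
    coboundary (f * g) = coboundary f * g + f * coboundary g := by
  ext p S h
  have hl : ∀ U ∈ S.powerset, InLattice T p U := fun U hU =>
    ⟨h.1, fun h2 => h.2 (Finset.mem_powerset.1 hU h2)⟩
  have hr : ∀ U ∈ S.powerset, InLattice T (shift p U) (S \ U) := fun U hU => by
    unfold InLattice at *
    rw [shift_time]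
    by_cases h2 : 2 ∈ U
    · simp [h2, h.2 (Finset.mem_powerset.1 hU h2)]
    · simp only [h2, if_false, add_zero, Finset.mem_sdiff]
      exact ⟨h.1, fun h3 => h.2 h3.1⟩
  have e1 : (coboundary f * g).1 p S = ∑ i ∈ S, ∑ U ∈ (S.erase i).powerset,
      (f.1 p U + f.1 (shift p {i}) U) * g.1 (shift p (insert i U)) ((S.erase i) \ U) := by
    rw [mul_apply, ← sum_erase_comm]
    refine Finset.sum_congr rfl fun U hU => ?_
    rw [coboundary_apply _ (hl U hU), Finset.sum_mul]
    refine Finset.sum_congr rfl fun i hi => ?_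
    have : S.erase i \ U.erase i = S \ U := by
      ext j; simp only [Finset.mem_sdiff, Finset.mem_erase]
      have := Finset.mem_powerset.1 hU hi
      by_cases hj : j = i
      · subst hj; tauto
      · tauto
    rw [Finset.insert_erase hi, this]
  have e2 : (f * coboundary g).1 p S = ∑ i ∈ S, ∑ U ∈ (S.erase i).powerset,
      f.1 p U * (g.1 (shift p U) ((S.erase i) \ U) +
        g.1 (shift p (insert i U)) ((S.erase i) \ U)) := by
    rw [mul_apply, ← sum_sdiff_comm]
    refine Finset.sum_congr rfl fun U hU => ?_
    rw [coboundary_apply _ (hr U hU), Finset.mul_sum]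
    refine Finset.sum_congr rfl fun i hi => ?_
    have hi' : i ∉ U := (Finset.mem_sdiff.1 hi).2
    rw [shift_shift _ (by simpa using hi'), Finset.erase_sdiff_comm, Finset.union_comm,
      ← Finset.insert_eq]
  rw [add_apply, e1, e2, coboundary_apply _ h, ← Finset.sum_add_distrib]
  refine Finset.sum_congr rfl fun i hi => ?_
  rw [mul_apply, mul_apply, ← Finset.sum_add_distrib, ← Finset.sum_add_distrib]
  refine Finset.sum_congr rfl fun U hU => ?_
  have hi' : i ∉ U := (Finset.subset_erase.1 (Finset.mem_powerset.1 hU)).2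
  rw [shift_shift _ (by simpa using hi'), ← Finset.insert_eq]
  -- The two middle terms `x * z` are equal and cancel.
  generalize f.1 p U = x
  generalize f.1 (shift p {i}) U = y
  generalize g.1 (shift p (insert i U)) (S.erase i \ U) = z
  generalize g.1 (shift p U) (S.erase i \ U) = w
  linear_combination (-x * z) * (CharTwo.two_eq_zero : (2 : ZMod 2) = 0)

/-- A cochain is relative to the boundary if it vanishes on the cells of the initial and of the
final time slice. These cochains form a two-sided ideal. -/
def Rel (f : Cochain L T) : Prop := ∀ p S, (p.2.2 = 0 ∨ p.2.2 = T) → 2 ∉ S → f.1 p S = 0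

lemma Rel.mul_right {f : Cochain L T} (hf : f.Rel) (g : Cochain L T) : (f * g).Rel := by
  intro p S hp hS
  refine Finset.sum_eq_zero fun U hU => ?_
  rw [hf p U hp fun h => hS (Finset.mem_powerset.1 hU h), zero_mul]

lemma Rel.mul_left {f : Cochain L T} (hf : f.Rel) (g : Cochain L T) : (g * f).Rel := by
  intro p S hp hS
  refine Finset.sum_eq_zero fun U hU => ?_
  have hU' : 2 ∉ U := fun h => hS (Finset.mem_powerset.1 hU h)
  rw [hf (shift p U) (S \ U) (by simpa [shift_time, hU'] using hp) fun h =>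
    hS (Finset.mem_sdiff.1 h).1, mul_zero]

/-- The sum of a cochain over all `n`-cells. -/
def integral (n : ℕ) : Cochain L T →+ ZMod 2 where
  toFun f := ∑ x : Cell L T n, f.1 x.pos x.axes
  map_zero' := by simp
  map_add' f g := by simp [Finset.sum_add_distrib]

/-- Summation over the cubes. -/
lemma sum_cubes (F : (ZMod L × ZMod L × ℕ) → Finset (Fin 3) → ZMod 2) :
    ∑ x : Cell L T 3, F x.pos x.axes =
      ∑ s : ZMod L × ZMod L, ∑ t ∈ Finset.range T, F (s.1, s.2, t) Finset.univ := by
  rw [Finset.sum_sigma']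
  refine Finset.sum_bij (fun x _ => ⟨(x.1.1.1, x.1.1.2.1), x.time⟩) ?_ ?_ ?_ ?_
  · rintro ⟨⟨⟨i, j, t⟩, S⟩, h1, h2⟩ -
    have hS : S = Finset.univ := by simpa using (Finset.card_eq_iff_eq_univ S).1 h1
    subst hS
    simpa [Cell.time] using h2
  · rintro ⟨⟨⟨i, j, t⟩, S⟩, h1, h2⟩ - ⟨⟨⟨i', j', t'⟩, S'⟩, h1', h2'⟩ - h
    have hS : S = Finset.univ := by simpa using (Finset.card_eq_iff_eq_univ S).1 h1
    have hS' : S' = Finset.univ := by simpa using (Finset.card_eq_iff_eq_univ S').1 h1'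
    simp only [Cell.time, Sigma.mk.injEq, Prod.mk.injEq, heq_eq_eq, Fin.val_inj] at h
    simp [hS, hS', h]
  · rintro ⟨⟨i, j⟩, t⟩ h
    have ht : t < T := by simpa using h
    exact ⟨⟨((i, j, ⟨t, by omega⟩), Finset.univ), by simp, fun _ => ht⟩, by simp, rfl⟩
  · rintro ⟨⟨⟨i, j, t⟩, S⟩, h1, h2⟩ -
    have hS : S = Finset.univ := by simpa using (Finset.card_eq_iff_eq_univ S).1 h1
    simp [Cell.pos, Cell.axes, Cell.time, hS]

/-- Stokes' theorem. In the periodic directions the two faces of the cubes cancel by translation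
invariance, in the time direction the sum telescopes. -/
lemma integral_coboundary {f : Cochain L T} (hf : f.Rel) : integral 3 (coboundary f) = 0 := by
  change ∑ x : Cell L T 3, (coboundary f).1 x.pos x.axes = 0
  rw [sum_cubes]
  have key : ∀ s : ZMod L × ZMod L, ∀ t ∈ Finset.range T,
      (coboundary f).1 (s.1, s.2, t) Finset.univ =
      (f.1 (s.1, s.2, t) (Finset.univ.erase 0) + f.1 (s.1 + 1, s.2, t) (Finset.univ.erase 0)) +
      (f.1 (s.1, s.2, t) (Finset.univ.erase 1) + f.1 (s.1, s.2 + 1, t) (Finset.univ.erase 1)) +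
      (f.1 (s.1, s.2, t + 1) (Finset.univ.erase 2) - f.1 (s.1, s.2, t) (Finset.univ.erase 2)) := by
    intro s t ht
    have ht : t < T := by simpa using ht
    rw [coboundary_apply _ ⟨by simp only; omega, fun _ => ht⟩]
    simp only [Fin.sum_univ_three, shift, Finset.sum_singleton, step, CharTwo.sub_eq_add]
    simp
    ring
  rw [Finset.sum_congr rfl fun s _ => Finset.sum_congr rfl (key s)]
  simp only [Finset.sum_add_distrib]
  have h0 : ∑ s : ZMod L × ZMod L, ∑ t ∈ Finset.range T,
      f.1 (s.1 + 1, s.2, t) (Finset.univ.erase 0) =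
      ∑ s : ZMod L × ZMod L, ∑ t ∈ Finset.range T, f.1 (s.1, s.2, t) (Finset.univ.erase 0) :=
    Fintype.sum_equiv (Equiv.addRight ((1, 0) : ZMod L × ZMod L)) _ _ fun s => by simp
  have h1 : ∑ s : ZMod L × ZMod L, ∑ t ∈ Finset.range T,
      f.1 (s.1, s.2 + 1, t) (Finset.univ.erase 1) =
      ∑ s : ZMod L × ZMod L, ∑ t ∈ Finset.range T, f.1 (s.1, s.2, t) (Finset.univ.erase 1) :=
    Fintype.sum_equiv (Equiv.addRight ((0, 1) : ZMod L × ZMod L)) _ _ fun s => by simp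
  rw [h0, h1, CharTwo.add_self_eq_zero, CharTwo.add_self_eq_zero, zero_add, zero_add]
  refine Finset.sum_eq_zero fun s _ => ?_
  rw [Finset.sum_range_sub fun t => f.1 (s.1, s.2, t) (Finset.univ.erase 2),
    hf _ _ (Or.inr rfl) (by simp), hf _ _ (Or.inl rfl) (by simp), sub_zero]

end Cochain

open Cochain

/-! ### Chains as cochains of a fixed degree -/

/-- A chain of degree `k` as a cochain of mixed degree. -/
def Chain.toCochain {k : ℕ} : Chain L T k →+ Cochain L T where
  toFun a := ⟨a.val, fun p S h => dif_neg fun h' => h ⟨h'.1, h'.2.2⟩⟩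
  map_zero' := by ext p S -; simp [Chain.val]
  map_add' a b := by
    ext p S -
    rw [Cochain.add_apply]
    simp only [Chain.val]
    split_ifs <;> simp

lemma Chain.toCochain_apply {k : ℕ} (a : Chain L T k) (p : ZMod L × ZMod L × ℕ)
    (S : Finset (Fin 3)) : (Chain.toCochain a).1 p S = a.val p S := rfl

lemma Chain.val_of_card_ne {k : ℕ} (a : Chain L T k) (p : ZMod L × ZMod L × ℕ)
    {S : Finset (Fin 3)} (h : S.card ≠ k) : a.val p S = 0 :=
  dif_neg fun h' => h h'.2.1

lemma Chain.val_pos_axes {k : ℕ} (a : Chain L T k) (x : Cell L T k) :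
    a.val x.pos x.axes = a x :=
  dif_pos ⟨x.1.1.2.2.2, x.2⟩

lemma Chain.val_of_inLattice {k : ℕ} (a : Chain L T k) {p : ZMod L × ZMod L × ℕ}
    {S : Finset (Fin 3)} (hS : S.card = k) (hp : InLattice T p S) :
    ∃ x : Cell L T k, x.pos = p ∧ x.axes = S ∧ a.val p S = a x :=
  ⟨⟨((p.1, p.2.1, ⟨p.2.2, hp.1⟩), S), hS, hp.2⟩, rfl, rfl, dif_pos ⟨hp.1, hS, hp.2⟩⟩

lemma Cell.inLattice {k : ℕ} (x : Cell L T k) : InLattice T x.pos x.axes := ⟨x.1.1.2.2.2, x.2.2⟩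

lemma Cell.ext_pos_axes {k : ℕ} {x y : Cell L T k} (h : x.pos = y.pos) (h' : x.axes = y.axes) :
    x = y := by
  obtain ⟨⟨⟨i, j, t⟩, S⟩, hx⟩ := x
  obtain ⟨⟨⟨i', j', t'⟩, S'⟩, hy⟩ := y
  simp only [Cell.pos, Prod.mk.injEq, Fin.val_inj] at h
  simp only [Cell.axes] at h'
  simp [h, h']

/-- Chains are equal if their cochains agree. -/
lemma Chain.toCochain_injective {k : ℕ} :
    Function.Injective (Chain.toCochain : Chain L T k → Cochain L T) := by
  intro a b h
  funext x
  rw [← a.val_pos_axes, ← b.val_pos_axes, ← Chain.toCochain_apply, h, Chain.toCochain_apply]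

lemma Chain.toCochain_cup {i j : ℕ} (a : Chain L T i) (b : Chain L T j) :
    Chain.toCochain (cup a b) = Chain.toCochain a * Chain.toCochain b := by
  ext p S h
  rw [Chain.toCochain_apply, mul_apply]
  by_cases hS : S.card = i + j
  · obtain ⟨x, rfl, rfl, hx⟩ := (cup a b).val_of_inLattice hS h
    rw [hx]; rfl
  · rw [Chain.val_of_card_ne _ _ hS, Finset.sum_eq_zero]
    intro U hU
    have := Finset.card_sdiff_add_card_eq_card (Finset.mem_powerset.1 hU)
    by_cases hU : U.card = i
    · rw [Chain.toCochain_apply b, Chain.val_of_card_ne b _ (by omega), mul_zero]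
    · rw [Chain.toCochain_apply, Chain.val_of_card_ne a _ hU, zero_mul]

lemma Chain.sum_ite_eq_val {k : ℕ} (a : Chain L T k) (p : ZMod L × ZMod L × ℕ)
    (S : Finset (Fin 3)) (hS : S.card = k) (hp : InLattice T p S) :
    ∑ y : Cell L T k, (if y.pos = p ∧ y.axes = S then 1 else 0) * a y = a.val p S := by
  obtain ⟨x, rfl, rfl, hx⟩ := a.val_of_inLattice hS hp
  rw [hx, Finset.sum_eq_single x]
  · simp
  · intro y _ hy
    rw [if_neg fun h => hy (Cell.ext_pos_axes h.1 h.2), zero_mul]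
  · simp

lemma Chain.toCochain_d {k : ℕ} (a : Chain L T k) :
    Chain.toCochain (dMat L T k *ᵥ a : Chain L T (k + 1)) = coboundary (Chain.toCochain a) := by
  ext p S h
  rw [coboundary_apply _ h, Chain.toCochain_apply]
  by_cases hS : S.card = k + 1
  · obtain ⟨x, rfl, rfl, hx⟩ := Chain.val_of_inLattice (dMat L T k *ᵥ a) hS h
    rw [hx]
    simp only [Matrix.mulVec, dotProduct, dMat, Finset.sum_mul]
    rw [Finset.sum_comm]
    refine Finset.sum_congr rfl fun i hi => ?_
    have hc : (x.axes.erase i).card = k := by rw [Finset.card_erase_of_mem hi, hS]; rfl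
    simp only [add_mul, Finset.sum_add_distrib]
    rw [Chain.sum_ite_eq_val a _ _ hc (InLattice.face h i),
      Chain.sum_ite_eq_val a _ _ hc (InLattice.shift_face h hi)]
    rfl
  · rw [Chain.val_of_card_ne _ _ hS, Finset.sum_eq_zero]
    intro i hi
    have hc : (S.erase i).card ≠ k := by
      rw [Finset.card_erase_of_mem hi]
      have := Finset.card_pos.2 ⟨i, hi⟩
      omega
    rw [Chain.toCochain_apply, Chain.toCochain_apply, Chain.val_of_card_ne a _ hc,
      Chain.val_of_card_ne a _ hc, add_zero]

lemma cupSum_eq_integral {i j k : ℕ} (a : Chain L T i) (b : Chain L T j) (c : Chain L T k) :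
    cupSum a b c = integral (i + j + k)
      (Chain.toCochain a * Chain.toCochain b * Chain.toCochain c) := by
  rw [← Chain.toCochain_cup, ← Chain.toCochain_cup]
  exact Finset.sum_congr rfl fun x _ => (Chain.val_pos_axes _ x).symm

/-- One colour of a triple of chains as a cochain. -/
def CChain.co {k : ℕ} (a : CChain L T k) (c : Color) : Cochain L T := Chain.toCochain (a.comp c)

lemma CChain.co_add {k : ℕ} (a b : CChain L T k) (c : Color) : (a + b).co c = a.co c + b.co c :=
  map_add Chain.toCochain (a.comp c) (b.comp c)

lemma CChain.co_d {k : ℕ} (a : CChain L T k) (c : Color) : (d a).co c = coboundary (a.co c) :=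
  Chain.toCochain_d (a.comp c)

lemma CChain.co_injective {k : ℕ} {a b : CChain L T k} (h : ∀ c, a.co c = b.co c) : a = b :=
  funext fun x => congrFun (Chain.toCochain_injective (h x.1)) x.2

lemma d_add {k : ℕ} (a b : CChain L T k) : d (a + b) = d a + d b :=
  CChain.co_injective fun c => by simp only [CChain.co_d, CChain.co_add, map_add]

lemma d_d {k : ℕ} (a : CChain L T k) : d (d a) = 0 :=
  CChain.co_injective fun c => by
    rw [CChain.co_d, CChain.co_d, coboundary_coboundary]
    exact (map_zero Chain.toCochain).symm

lemma rel_of_mem_interior {v : CChain L T 0} (hv : v ∈ interior L T) (c : Color) :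
    (v.co c).Rel := by
  intro p S hp hS
  by_cases h : S.card = 0 ∧ InLattice T p S
  · obtain ⟨x, rfl, rfl, hx⟩ := (v.comp c).val_of_inLattice h.1 h.2
    exact hx.trans (hv c x hp)
  · by_cases hS : S.card = 0
    · exact (v.co c).2 _ _ fun h' => h ⟨hS, h'⟩
    · exact Chain.val_of_card_ne _ _ hS

/-! ### Gauge variance and the twisted forms -/

namespace Cochain

/-- The integral of a triple cup product over all cubes. -/
def integral₃ (f g h : Cochain L T) : ZMod 2 := integral 3 (f * g * h)

lemma integral₃_add_left (f f' g h : Cochain L T) :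
    integral₃ (f + f') g h = integral₃ f g h + integral₃ f' g h := by
  simp only [integral₃, add_mul, map_add]

lemma integral₃_add_mid (f g g' h : Cochain L T) :
    integral₃ f (g + g') h = integral₃ f g h + integral₃ f g' h := by
  simp only [integral₃, add_mul, mul_add, map_add]

lemma integral₃_add_right (f g h h' : Cochain L T) :
    integral₃ f g (h + h') = integral₃ f g h + integral₃ f g h' := by
  simp only [integral₃, mul_add, map_add]

lemma sum_integral₃_coboundary {f g h : Cochain L T} (hr : f.Rel ∨ g.Rel ∨ h.Rel) :
    integral₃ (coboundary f) g h + integral₃ f (coboundary g) h +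
      integral₃ f g (coboundary h) = 0 := by
  have : (f * g * h).Rel := by
    rcases hr with hr | hr | hr
    · exact (hr.mul_right g).mul_right h
    · exact (hr.mul_left f).mul_right h
    · exact hr.mul_left _
  rw [← integral_coboundary this, coboundary_mul, coboundary_mul, add_mul, map_add, map_add]
  rfl

/-- Partial integration, with the coboundary on the first factor. -/
lemma integral₃_coboundary_left {f g h : Cochain L T} (hr : f.Rel ∨ g.Rel ∨ h.Rel) :
    integral₃ (coboundary f) g h =
      integral₃ f (coboundary g) h + integral₃ f g (coboundary h) := by
  rw [← CharTwo.add_eq_zero, ← add_assoc, sum_integral₃_coboundary hr]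

/-- Partial integration, with the coboundary on the second factor. -/
lemma integral₃_coboundary_mid {f g h : Cochain L T} (hr : f.Rel ∨ g.Rel ∨ h.Rel) :
    integral₃ f (coboundary g) h =
      integral₃ (coboundary f) g h + integral₃ f g (coboundary h) := by
  rw [← CharTwo.add_eq_zero, ← add_assoc, add_comm (integral₃ f (coboundary g) h),
    sum_integral₃_coboundary hr]

/-- Partial integration, with the coboundary on the third factor. -/
lemma integral₃_coboundary_right {f g h : Cochain L T} (hr : f.Rel ∨ g.Rel ∨ h.Rel) :
    integral₃ f g (coboundary h) =
      integral₃ (coboundary f) g h + integral₃ f (coboundary g) h := by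
  rw [← CharTwo.add_eq_zero, add_comm, sum_integral₃_coboundary hr]

lemma integral₃_zero_mid (f h : Cochain L T) : integral₃ f 0 h = 0 := by
  simp [integral₃]

lemma integral₃_zero_left (f h : Cochain L T) : integral₃ 0 f h = 0 := by
  simp [integral₃]

lemma integral₃_zero_right (f h : Cochain L T) : integral₃ f h 0 = 0 := by
  simp [integral₃]

end Cochain

lemma action_eq (a : CChain L T 1) : action a = integral₃ (a.co .r) (a.co .g) (a.co .b) :=
  cupSum_eq_integral _ _ _

lemma twistForm_eq (b : CChain L T 2) (x : CChain L T 1) (v : CChain L T 0) :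
    twistForm b x v =
      integral₃ (x.co .r) (b.co .g) (v.co .b) + integral₃ (b.co .r) (x.co .g) (v.co .b) +
      integral₃ (x.co .r) (v.co .g) (b.co .b) + integral₃ (b.co .r) (v.co .g) (x.co .b) +
      integral₃ (v.co .r) (x.co .g) (b.co .b) + integral₃ (v.co .r) (b.co .g) (x.co .b) := by
  simp only [twistForm, cupSum_eq_integral]
  rfl

/-- The part of the gauge variance that only depends on the flux: the terms of second and
third order in the gauge transformation. -/
def gaugeOffset (b : CChain L T 2) (v : CChain L T 0) : ZMod 2 :=
  integral₃ (v.co .r) (coboundary (v.co .g)) (b.co .b) +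
    integral₃ (v.co .r) (b.co .g) (coboundary (v.co .b)) +
    integral₃ (b.co .r) (coboundary (v.co .g)) (v.co .b)

/-- Up to terms that only depend on the flux, the gauge variance is the form `twistForm`: by partial
integration, the terms of first order in `v` are the six terms of `twistForm`, and those of higher
order see `a` only through `da`. -/
lemma gaugeVar_eq (a : CChain L T 1) {v : CChain L T 0} (hv : v ∈ interior L T) :
    gaugeVar a v = twistForm (d a) a v + gaugeOffset (d a) v := by
  have hr := rel_of_mem_interior hv .r
  have hg := rel_of_mem_interior hv .g
  have hb := rel_of_mem_interior hv .b
  rw [gaugeVar, action_eq, action_eq, twistForm_eq, gaugeOffset]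
  simp only [CChain.co_add, CChain.co_d, integral₃_add_left, integral₃_add_mid,
    integral₃_add_right]
  rw [integral₃_coboundary_left (f := v.co .r) (g := a.co .g) (h := a.co .b) (.inl hr),
    integral₃_coboundary_left (f := v.co .r) (g := coboundary (v.co .g)) (h := a.co .b) (.inl hr),
    integral₃_coboundary_left (f := v.co .r) (g := a.co .g) (h := coboundary (v.co .b)) (.inl hr),
    integral₃_coboundary_left (f := v.co .r) (g := coboundary (v.co .g))
      (h := coboundary (v.co .b)) (.inl hr),
    integral₃_coboundary_mid (f := a.co .r) (g := v.co .g) (h := a.co .b) (.inr (.inl hg)),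
    integral₃_coboundary_right (f := a.co .r) (g := a.co .g) (h := v.co .b) (.inr (.inr hb)),
    integral₃_coboundary_right (f := a.co .r) (g := coboundary (v.co .g)) (h := v.co .b)
      (.inr (.inr hb))]
  simp only [coboundary_coboundary, integral₃_zero_mid, integral₃_zero_right]
  ring

lemma twistForm_add_left (b : CChain L T 2) (x y : CChain L T 1) (v : CChain L T 0) :
    twistForm b (x + y) v = twistForm b x v + twistForm b y v := by
  simp only [twistForm_eq, CChain.co_add, integral₃_add_left, integral₃_add_mid,
    integral₃_add_right]
  ring

/-- A linear functional on a finite power of a ring, evaluated on the basis vectors. -/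
lemma dotProduct_single_apply {ι : Type} [Fintype ι] [DecidableEq ι] (f : (ι → ZMod 2) →+ ZMod 2)
    (x : ι → ZMod 2) : x ⬝ᵥ (fun i => f (Pi.single i 1)) = f x := by
  conv_rhs => rw [← Finset.univ_sum_single x, map_sum]
  refine Finset.sum_congr rfl fun i _ => ?_
  obtain h | h : x i = 0 ∨ x i = 1 := by
    generalize x i = z
    revert z; decide
  · simp [h]
  · simp [h]

lemma dotProduct_twist (b : CChain L T 2) (x : CChain L T 1) (v : CChain L T 0) :
    x ⬝ᵥ twist b v = twistForm b x v :=
  dotProduct_single_apply (AddMonoidHom.mk' (fun x => twistForm b x v)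
    fun x y => twistForm_add_left b x y v) x

lemma dotProduct_M (b : CChain L T 2) (w v : CChain L T 0) :
    w ⬝ᵥ M b v = twistForm b (d w) v :=
  dotProduct_single_apply (AddMonoidHom.mk' (fun w => twistForm b (d w) v)
    fun x y => by simp only [d_add, twistForm_add_left]) w

/-- `dᵀ` is the transpose of `d`. -/
lemma dotProduct_dT {k : ℕ} (c : CChain L T (k + 1)) (w : CChain L T k) :
    w ⬝ᵥ dT c = d w ⬝ᵥ c := by
  simp only [dotProduct, Fintype.sum_prod_type]
  refine Finset.sum_congr rfl fun l _ => ?_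
  change w.comp l ⬝ᵥ ((dMat L T k)ᵀ *ᵥ c.comp l) = (dMat L T k *ᵥ w.comp l) ⬝ᵥ c.comp l
  rw [Matrix.dotProduct_mulVec, Matrix.vecMul_transpose]

lemma dT_twist (b : CChain L T 2) (v : CChain L T 0) : dT (twist b v) = M b v := by
  refine dotProduct_eq _ _ fun w => ?_
  rw [dotProduct_comm, dotProduct_dT, dotProduct_twist, dotProduct_comm, dotProduct_M]

lemma gaugeVar_add_d_sub (a : CChain L T 1) (w : CChain L T 0) {v : CChain L T 0}
    (hv : v ∈ interior L T) :
    gaugeVar (a + d w) v - gaugeVar a v = w ⬝ᵥ M (d a) v := by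
  rw [gaugeVar_eq _ hv, gaugeVar_eq _ hv, d_add, d_d, add_zero, twistForm_add_left, dotProduct_M]
  ring

lemma M_symm {b : CChain L T 2} (hb : d b = 0) {w v : CChain L T 0} (hw : w ∈ interior L T) :
    w ⬝ᵥ M b v = v ⬝ᵥ M b w := by
  have hr := rel_of_mem_interior hw .r
  have hg := rel_of_mem_interior hw .g
  have hB := rel_of_mem_interior hw .b
  have hd : ∀ c, coboundary (b.co c) = 0 := fun c => by
    rw [← CChain.co_d, hb]
    exact map_zero Chain.toCochain
  rw [dotProduct_M, dotProduct_M, twistForm_eq, twistForm_eq]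
  simp only [CChain.co_d]
  rw [integral₃_coboundary_left (f := w.co .r) (g := b.co .g) (h := v.co .b) (.inl hr),
    integral₃_coboundary_mid (f := b.co .r) (g := w.co .g) (h := v.co .b) (.inr (.inl hg)),
    integral₃_coboundary_left (f := w.co .r) (g := v.co .g) (h := b.co .b) (.inl hr),
    integral₃_coboundary_right (f := b.co .r) (g := v.co .g) (h := w.co .b) (.inr (.inr hB)),
    integral₃_coboundary_mid (f := v.co .r) (g := w.co .g) (h := b.co .b) (.inr (.inl hg)),
    integral₃_coboundary_right (f := v.co .r) (g := b.co .g) (h := w.co .b) (.inr (.inr hB))]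
  simp only [hd, integral₃_zero_mid, integral₃_zero_right, integral₃_zero_left]
  ring

/-- On the kernel of `M`, the gauge variance is additive. -/
lemma gaugeVar_add {a : CChain L T 1} {v v' : CChain L T 0} (hv : v ∈ interior L T)
    (hM : M (d a) v = 0) : gaugeVar a (v + v') = gaugeVar a v + gaugeVar a v' := by
  have h := gaugeVar_add_d_sub a v' hv
  rw [hM, dotProduct_zero] at h
  simp only [gaugeVar, d_add] at h ⊢
  rw [← add_assoc, add_right_comm]
  linear_combination h

/-! ### Cocycles away from the flux -/

lemma Cochain.shift_singleton_proj (p : ℤ × ℤ × ℕ) (i : Fin 3) :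
    shift (proj L p) {i} = proj L (p + step ℤ i) := by
  fin_cases i <;> simp [shift, proj, step]

lemma exists_int_primitive (f : ℤ → ZMod 2) : ∃ F : ℤ → ZMod 2, ∀ n, F (n + 1) = F n + f n := by
  refine ⟨fun n => ∑ k ∈ Finset.Ico 0 n, f k + ∑ k ∈ Finset.Ico n 0, f k, fun n => ?_⟩
  rcases le_or_gt 0 n with hn | hn
  · simp only
    have h : Finset.Ico 0 (n + 1) = insert n (Finset.Ico 0 n) := by ext k; simp; omega
    rw [h, Finset.sum_insert (by simp), Finset.Ico_eq_empty (by omega : ¬ n + 1 < 0),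
      Finset.Ico_eq_empty (by omega : ¬ n < 0)]
    simp [add_comm]
  · simp only
    have h : Finset.Ico n 0 = insert n (Finset.Ico (n + 1) 0) := by ext k; simp; omega
    rw [h, Finset.sum_insert (by simp), Finset.Ico_eq_empty (by omega : ¬ 0 < n + 1),
      Finset.Ico_eq_empty (by omega : ¬ 0 < n)]
    linear_combination (-f n) * (CharTwo.two_eq_zero : (2 : ZMod 2) = 0)

lemma Cochain.cocycle_square {f : Cochain L T} (hf : coboundary f = 0)
    {p : ZMod L × ZMod L × ℕ} {i j : Fin 3} (hij : i ≠ j) (hp : InLattice T p {i, j}) :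
    f.1 (shift p {i}) {j} = f.1 p {i} + f.1 p {j} + f.1 (shift p {j}) {i} := by
  have h := coboundary_apply f hp
  have h1 : ({i, j} : Finset (Fin 3)).erase i = {j} := by simp [hij]
  have h2 : ({i, j} : Finset (Fin 3)).erase j = {i} := by
    rw [Finset.pair_comm]; simp [hij.symm]
  rw [hf, zero_apply, Finset.sum_pair hij, h1, h2] at h
  linear_combination h + (f.1 (shift p {i}) {j}) * (CharTwo.two_eq_zero : (2 : ZMod 2) = 0)

/-- The universal cover `ℤ × ℤ × [0, T]` is simply connected: the lift of a 1-cocycle has a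
primitive. The primitive sums the cocycle along the path from the origin that runs first in
direction 0, then in direction 1, then in the time direction. -/
lemma Cochain.exists_primitive_lift {f : Cochain L T} (hf : coboundary f = 0) :
    ∃ W : ℤ × ℤ × ℕ → ZMod 2, ∀ p i, InLattice T (proj L p) {i} →
      W (p + step ℤ i) = W p + f.1 (proj L p) {i} := by
  obtain ⟨A, hA⟩ := exists_int_primitive fun m => f.1 (proj L (m, 0, 0)) {0}
  choose B hB using fun m => exists_int_primitive fun n => f.1 (proj L (m, n, 0)) {1}
  have hsq : ∀ (p : ℤ × ℤ × ℕ) (i j : Fin 3), i ≠ j → InLattice T (proj L p) {i, j} →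
      f.1 (proj L (p + step ℤ i)) {j} =
        f.1 (proj L p) {i} + f.1 (proj L p) {j} + f.1 (proj L (p + step ℤ j)) {i} := by
    intro p i j hij hp
    rw [← shift_singleton_proj, ← shift_singleton_proj]
    exact cocycle_square hf hij hp
  -- `A` and `B m` are primitives along the first two parts of the path, up to constants.
  let W : ℤ → ℤ → ℕ → ZMod 2 := fun m n t =>
    (A m - A 0) + (B m n - B m 0) + ∑ s ∈ Finset.range t, f.1 (proj L (m, n, s)) {2}
  have hWt : ∀ m n t, W m n (t + 1) = W m n t + f.1 (proj L (m, n, t)) {2} := by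
    intro m n t
    simp only [W, Finset.sum_range_succ]; ring
  have h2 : (2 : ZMod 2) = 0 := CharTwo.two_eq_zero
  have hWy : ∀ m n t, t ≤ T → W m (n + 1) t = W m n t + f.1 (proj L (m, n, t)) {1} := by
    intro m n t
    induction t with
    | zero => intro _; simp only [W, hB, Finset.range_zero, Finset.sum_empty]; ring
    | succ t ih =>
      intro ht
      have h := hsq (m, n, t) 1 2 (by decide) ⟨by simp [proj]; omega, fun _ => ht⟩
      simp only [step, Matrix.cons_val_one, Matrix.cons_val, Prod.mk_add_mk, add_zero] at h
      rw [hWt, hWt, ih (by omega), h]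
      linear_combination (f.1 (proj L (m, n, t)) {1}) * h2
  have hWx : ∀ m n t, t ≤ T → W (m + 1) n t = W m n t + f.1 (proj L (m, n, t)) {0} := by
    intro m n t
    induction t with
    | zero =>
      intro _
      -- The defect of the claim at time 0 does not depend on `n`, and vanishes for `n = 0`.
      have hstep : ∀ n, W (m + 1) (n + 1) 0 + W m (n + 1) 0 + f.1 (proj L (m, n + 1, 0)) {0} =
          W (m + 1) n 0 + W m n 0 + f.1 (proj L (m, n, 0)) {0} := by
        intro n
        have h := hsq (m, n, 0) 0 1 (by decide) ⟨by simp [proj], by simp⟩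
        simp only [step, Matrix.cons_val_zero, Matrix.cons_val_one, Prod.mk_add_mk, add_zero] at h
        rw [hWy _ _ _ (Nat.zero_le _), hWy _ _ _ (Nat.zero_le _), h]
        linear_combination (f.1 (proj L (m, n, 0)) {1} + f.1 (proj L (m, n + 1, 0)) {0}) * h2
      have h0 : ∀ n, W (m + 1) n 0 + W m n 0 + f.1 (proj L (m, n, 0)) {0} = 0 := by
        intro n
        induction n using Int.induction_on with
        | zero =>
          simp only [W, hA, Finset.range_zero, Finset.sum_empty]
          linear_combination (A m - A 0 + f.1 (proj L (m, 0, 0)) {0}) * h2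
        | succ n ih => rw [hstep, ih]
        | pred n ih => rw [← hstep, sub_add_cancel, ih]
      linear_combination h0 n - (W m n 0 + f.1 (proj L (m, n, 0)) {0}) * h2
    | succ t ih =>
      intro ht
      have h := hsq (m, n, t) 0 2 (by decide) ⟨by simp [proj]; omega, fun _ => ht⟩
      simp only [step, Matrix.cons_val_zero, Matrix.cons_val, Prod.mk_add_mk, add_zero] at h
      rw [hWt, hWt, ih (by omega), h]
      linear_combination (f.1 (proj L (m, n, t)) {0}) * h2
  refine ⟨fun p => W p.1 p.2.1 p.2.2, ?_⟩
  rintro ⟨m, n, t⟩ i hi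
  have ht : t ≤ T := Nat.lt_succ_iff.1 hi.1
  fin_cases i
  · simpa [step] using hWx m n t ht
  · simpa [step] using hWy m n t ht
  · simpa [step] using hWt m n t

/-- The step from a vertex of the lattice along an edge next to the flux. -/
def FluxStep (b : CChain L T 2) (p q : ZMod L × ZMod L × ℕ) : Prop :=
  ∃ (e : Cell L T 1) (i : Fin 3), NextToFlux b e ∧ e.axes = {i} ∧ p = e.pos ∧ q = shift p {i}

/-- Paths along edges next to the flux lift to the universal cover. -/
lemma FluxStep.lift {b : CChain L T 2} {P Q : ZMod L × ZMod L × ℕ}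
    (h : Relation.EqvGen (FluxStep b) P Q) :
    (∀ p, proj L p = P → ∃ q, proj L q = Q ∧ Relation.EqvGen (FluxAdj b) p q) ∧
      (∀ q, proj L q = Q → ∃ p, proj L p = P ∧ Relation.EqvGen (FluxAdj b) p q) := by
  induction h with
  | refl P => exact ⟨fun p hp => ⟨p, hp, .refl p⟩, fun p hp => ⟨p, hp, .refl p⟩⟩
  | symm P Q _ ih =>
    refine ⟨fun p hp => ?_, fun p hp => ?_⟩
    · obtain ⟨q, hq, h⟩ := ih.2 p hp
      exact ⟨q, hq, .symm _ _ h⟩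
    · obtain ⟨q, hq, h⟩ := ih.1 p hp
      exact ⟨q, hq, .symm _ _ h⟩
  | trans P Q R _ _ ih1 ih2 =>
    refine ⟨fun p hp => ?_, fun r hr => ?_⟩
    · obtain ⟨q, hq, h⟩ := ih1.1 p hp
      obtain ⟨r, hr, h'⟩ := ih2.1 q hq
      exact ⟨r, hr, .trans _ _ _ h h'⟩
    · obtain ⟨q, hq, h⟩ := ih2.2 r hr
      obtain ⟨p, hp, h'⟩ := ih1.2 q hq
      exact ⟨p, hp, .trans _ _ _ h' h⟩
  | rel P Q h =>
    obtain ⟨e, i, he, hi, hP, hQ⟩ := h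
    refine ⟨fun p hp => ⟨p + step ℤ i, ?_, .rel _ _ ⟨e, i, he, hi, hp.trans hP, rfl⟩⟩,
      fun q hq => ?_⟩
    · rw [← shift_singleton_proj, hp, hQ]
    · let p : ℤ × ℤ × ℕ := (q.1 - (step ℤ i).1, q.2.1 - (step ℤ i).2.1, P.2.2)
      obtain ⟨m, n, t⟩ := q
      have hpP : proj L p = P := by
        rw [hQ] at hq
        obtain ⟨P1, P2, P3⟩ := P
        fin_cases i <;>
        · simp [proj, shift, step] at hq
          simp [p, proj, step, hq]
      have hq' : (m, n, t) = p + step ℤ i := by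
        rw [hQ] at hq
        have h3 : t = (shift P {i}).2.2 := congrArg (fun z => z.2.2) hq
        simp only [shift, Finset.sum_singleton] at h3
        fin_cases i <;> simp [p, step] at h3 ⊢ <;> exact h3
      exact ⟨p, hpP, .rel _ _ ⟨e, i, he, hi, hpP.trans hP, hq'⟩⟩

lemma proj_surjective (P : ZMod L × ZMod L × ℕ) : ∃ p, proj L p = P := by
  obtain ⟨m, hm⟩ := ZMod.intCast_surjective P.1
  obtain ⟨n, hn⟩ := ZMod.intCast_surjective P.2.1
  exact ⟨(m, n, P.2.2), by simp [proj, hm, hn]⟩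

/-- If there are no non-contractible loops, the vertices can be lifted to the universal cover such
that the edges next to the flux become edges of the universal cover. One fixes a lift in each
component of the graph of these edges, and continues it along paths. -/
lemma NoNoncontractibleLoop.exists_section {b : CChain L T 2} (hb : NoNoncontractibleLoop b) :
    ∃ ℓ : ZMod L × ZMod L × ℕ → ℤ × ℤ × ℕ, (∀ P, proj L (ℓ P) = P) ∧
      ∀ (e : Cell L T 1) (i : Fin 3), NextToFlux b e → e.axes = {i} →
        ℓ (shift e.pos {i}) = ℓ e.pos + step ℤ i := by
  let s : Setoid (ZMod L × ZMod L × ℕ) := Relation.EqvGen.setoid (FluxStep b)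
  choose base hbase using proj_surjective (L := L)
  let rep : ZMod L × ZMod L × ℕ → ZMod L × ZMod L × ℕ := fun P => (⟦P⟧ : Quotient s).out
  have hrep : ∀ P, Relation.EqvGen (FluxStep b) (rep P) P := fun P => Quotient.mk_out P
  choose ℓ hℓ hpath using fun P => (FluxStep.lift (hrep P)).1 _ (hbase (rep P))
  refine ⟨ℓ, hℓ, fun e i he hi => ?_⟩
  have hstep : FluxStep b e.pos (shift e.pos {i}) := ⟨e, i, he, hi, rfl, rfl⟩
  have hr : rep e.pos = rep (shift e.pos {i}) :=
    congrArg Quotient.out (Quotient.sound (s := s) (Relation.EqvGen.rel _ _ hstep))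
  -- Both lifts of the endpoint of `e` are connected to the base point of its component.
  have h1 := hpath e.pos
  rw [hr] at h1
  refine hb _ _ (.trans _ _ _ (.symm _ _ (hpath _)) (.trans _ _ _ h1
    (.rel _ _ ⟨e, i, he, hi, hℓ _, rfl⟩))) ?_
  rw [hℓ, ← shift_singleton_proj, hℓ]

/-- If there are no non-contractible loops, a cocycle can be gauged away from the edges next to
the flux. -/
lemma NoNoncontractibleLoop.exists_gauge {b : CChain L T 2} (hb : NoNoncontractibleLoop b)
    {x : CChain L T 1} (hx : d x = 0) :
    ∃ w : CChain L T 0, ∀ c e, NextToFlux b e → (x + d w) (c, e) = 0 := by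
  have hx' : ∀ c, coboundary (x.co c) = 0 := fun c => by
    rw [← CChain.co_d, hx]
    exact map_zero Chain.toCochain
  choose W hW using fun c => exists_primitive_lift (hx' c)
  obtain ⟨ℓ, hℓ, hstep⟩ := hb.exists_section
  let w : CChain L T 0 := fun y => W y.1 (ℓ y.2.pos)
  have hw : ∀ c p, InLattice T p ∅ → (w.co c).1 p ∅ = W c (ℓ p) := by
    intro c p hp
    obtain ⟨y, rfl, -, hy⟩ := (w.comp c).val_of_inLattice rfl hp
    exact hy
  refine ⟨w, fun c e he => ?_⟩
  obtain ⟨i, hi⟩ := Finset.card_eq_one.1 e.2.1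
  have hi : e.axes = {i} := hi
  have hin : InLattice T e.pos {i} := hi ▸ e.inLattice
  have h1 : (x + d w) (c, e) = ((x + d w).co c).1 e.pos {i} := by
    rw [← hi]
    exact (((x + d w).comp c).val_pos_axes e).symm
  have h2 := hW c (ℓ e.pos) i (by rwa [hℓ])
  rw [← hstep e i he hi, hℓ] at h2
  have h3 : InLattice T (shift e.pos {i}) ∅ := by
    simpa using InLattice.shift_face hin (Finset.mem_singleton_self i)
  rw [h1, CChain.co_add, CChain.co_d, Cochain.add_apply, coboundary_apply _ hin,
    Finset.sum_singleton, Finset.erase_singleton, hw c _ ⟨hin.1, by simp⟩, hw c _ h3, h2]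
  linear_combination (((x.co c).1 e.pos {i}) + W c (ℓ e.pos)) *
    (CharTwo.two_eq_zero : (2 : ZMod 2) = 0)

/-- A 0-chain acts on cochains from the left by its values on the first vertices of the cells. -/
lemma CChain.co_mul_apply (v : CChain L T 0) (c : Color) (f : Cochain L T)
    (p : ZMod L × ZMod L × ℕ) (S : Finset (Fin 3)) :
    (v.co c * f).1 p S = (v.co c).1 p ∅ * f.1 p S := by
  rw [mul_apply, Finset.sum_eq_single ∅]
  · simp [shift_empty]
  · intro U _ hU
    have h : (v.co c).1 p U = 0 := Chain.val_of_card_ne _ _ fun h => hU (Finset.card_eq_zero.1 h)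
    rw [h, zero_mul]
  · simp

/-- A 0-chain acts on cochains from the right by its values on the last vertices of the cells. -/
lemma CChain.mul_co_apply (v : CChain L T 0) (c : Color) (f : Cochain L T)
    (p : ZMod L × ZMod L × ℕ) (S : Finset (Fin 3)) :
    (f * v.co c).1 p S = f.1 p S * (v.co c).1 (shift p S) ∅ := by
  rw [mul_apply, Finset.sum_eq_single S]
  · simp
  · intro U hU hUS
    have h : (v.co c).1 (shift p U) (S \ U) = 0 := by
      refine Chain.val_of_card_ne _ _ fun h => hUS ?_
      rw [Finset.card_eq_zero, Finset.sdiff_eq_empty_iff_subset] at h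
      exact (Finset.mem_powerset.1 hU).antisymm h
    rw [h, mul_zero]
  · simp

/-- A cochain is carried by the flux if it vanishes on all cells other than the faces with flux of
some colour. -/
def FluxSupported (b : CChain L T 2) (f : Cochain L T) : Prop :=
  ∀ p S, (∀ (c : Color) (y : Cell L T 2), y.pos = p → y.axes = S → b (c, y) = 0) → f.1 p S = 0

lemma fluxSupported_co (b : CChain L T 2) (c : Color) : FluxSupported b (b.co c) := by
  intro p S h
  by_cases hS : S.card = 2 ∧ InLattice T p S
  · obtain ⟨y, hy, hy', e⟩ := (b.comp c).val_of_inLattice hS.1 hS.2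
    exact e.trans (h c y hy hy')
  · by_cases hS' : S.card = 2
    · exact (b.co c).2 _ _ fun h' => hS ⟨hS', h'⟩
    · exact Chain.val_of_card_ne _ _ hS'

lemma FluxSupported.co_mul {b : CChain L T 2} {f : Cochain L T} (hf : FluxSupported b f)
    (v : CChain L T 0) (c : Color) : FluxSupported b (v.co c * f) := fun p S h => by
  rw [CChain.co_mul_apply, hf p S h, mul_zero]

lemma FluxSupported.mul_co {b : CChain L T 2} {f : Cochain L T} (hf : FluxSupported b f)
    (v : CChain L T 0) (c : Color) : FluxSupported b (f * v.co c) := fun p S h => by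
  rw [CChain.mul_co_apply, hf p S h, zero_mul]

/-- The cup product, on a cube, of a 1-chain that vanishes next to the flux and a cochain carried by
the flux. -/
lemma co_mul_fluxSupported {b : CChain L T 2} {x : CChain L T 1}
    (hx : ∀ c e, NextToFlux b e → x (c, e) = 0) {f : Cochain L T} (hf : FluxSupported b f)
    (c : Color) (y : Cell L T 3) : (x.co c * f).1 y.pos y.axes = 0 := by
  refine Finset.sum_eq_zero fun U hU => ?_
  by_contra h0
  have hxU : (x.co c).1 y.pos U ≠ 0 := left_ne_zero_of_mul h0
  have hfU := right_ne_zero_of_mul h0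
  have hc : U.card = 1 := by
    by_contra h
    exact hxU (Chain.val_of_card_ne _ _ h)
  have hin : InLattice T y.pos U := by
    by_contra h
    exact hxU ((x.co c).2 _ _ h)
  obtain ⟨e, he, rfl, hxe⟩ := (x.comp c).val_of_inLattice hc hin
  refine hfU (hf _ _ fun c' z hz hz' => ?_)
  by_contra hbz
  refine hxU (hxe.trans (hx c e ⟨c', z, y, hbz, ?_, .inl ⟨he, hz⟩⟩))
  rw [hz', Finset.inter_sdiff_self]

/-- The cup product, on a cube, of a cochain carried by the flux and a 1-chain that vanishes next to
the flux. -/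
lemma fluxSupported_mul_co {b : CChain L T 2} {x : CChain L T 1}
    (hx : ∀ c e, NextToFlux b e → x (c, e) = 0) {f : Cochain L T} (hf : FluxSupported b f)
    (c : Color) (y : Cell L T 3) : (f * x.co c).1 y.pos y.axes = 0 := by
  refine Finset.sum_eq_zero fun U hU => ?_
  by_contra h0
  have hfU := left_ne_zero_of_mul h0
  have hxU : (x.co c).1 (shift y.pos U) (y.axes \ U) ≠ 0 := right_ne_zero_of_mul h0
  have hc : (y.axes \ U).card = 1 := by
    by_contra h
    exact hxU (Chain.val_of_card_ne _ _ h)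
  have hin : InLattice T (shift y.pos U) (y.axes \ U) := by
    by_contra h
    exact hxU ((x.co c).2 _ _ h)
  obtain ⟨e, he, heU, hxe⟩ := (x.comp c).val_of_inLattice hc hin
  refine hfU (hf _ _ fun c' z hz hz' => ?_)
  by_contra hbz
  refine hxU (hxe.trans (hx c e ⟨c', z, y, hbz, ?_, .inr ⟨hz, by rw [he, hz']⟩⟩))
  rw [heU, hz', Finset.sdiff_inter_self]

lemma twistForm_eq_zero_of_next {b : CChain L T 2} {x : CChain L T 1}
    (hx : ∀ c e, NextToFlux b e → x (c, e) = 0) (v : CChain L T 0) : twistForm b x v = 0 := by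
  have hb := fluxSupported_co b
  have h1 : ∀ (c c' c'' : Color), integral₃ (x.co c) (b.co c') (v.co c'') = 0 := fun c c' c'' =>
    Finset.sum_eq_zero fun y _ => by
      rw [CChain.mul_co_apply, co_mul_fluxSupported hx (hb c'), zero_mul]
  have h2 : ∀ (c c' c'' : Color), integral₃ (b.co c) (x.co c') (v.co c'') = 0 := fun c c' c'' =>
    Finset.sum_eq_zero fun y _ => by
      rw [CChain.mul_co_apply, fluxSupported_mul_co hx (hb c), zero_mul]
  have h3 : ∀ (c c' c'' : Color), integral₃ (x.co c) (v.co c') (b.co c'') = 0 := fun c c' c'' =>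
    Finset.sum_eq_zero fun y _ => by
      rw [mul_assoc, co_mul_fluxSupported hx ((hb c'').co_mul v c')]
  have h4 : ∀ (c c' c'' : Color), integral₃ (b.co c) (v.co c') (x.co c'') = 0 := fun c c' c'' =>
    Finset.sum_eq_zero fun y _ => fluxSupported_mul_co hx ((hb c).mul_co v c') c'' y
  have h5 : ∀ (c c' c'' : Color), integral₃ (v.co c) (x.co c') (b.co c'') = 0 := fun c c' c'' =>
    Finset.sum_eq_zero fun y _ => by
      rw [mul_assoc, CChain.co_mul_apply, co_mul_fluxSupported hx (hb c''), mul_zero]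
  have h6 : ∀ (c c' c'' : Color), integral₃ (v.co c) (b.co c') (x.co c'') = 0 := fun c c' c'' =>
    Finset.sum_eq_zero fun y _ => by
      rw [mul_assoc, CChain.co_mul_apply, fluxSupported_mul_co hx (hb c'), mul_zero]
  simp only [twistForm_eq, h1, h2, h3, h4, h5, h6, add_zero]

/-- Without non-contractible loops, the gauge variance in the kernel of `M` only depends on the
flux. -/
lemma NoNoncontractibleLoop.gaugeVar_eq {b : CChain L T 2} (hb : NoNoncontractibleLoop b)
    {a a' : CChain L T 1} (ha : d a = b) (ha' : d a' = b) {v : CChain L T 0}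
    (hv : v ∈ interior L T) (hM : M b v = 0) : gaugeVar a v = gaugeVar a' v := by
  have hx : d (a + a') = 0 := by
    rw [d_add, ha, ha']
    exact funext fun _ => CharTwo.add_self_eq_zero _
  obtain ⟨w, hw⟩ := hb.exists_gauge hx
  have h := twistForm_eq_zero_of_next hw v
  rw [twistForm_add_left, ← dotProduct_M, hM, dotProduct_zero, add_zero, twistForm_add_left,
    CharTwo.add_eq_zero] at h
  rw [TQD.gaugeVar_eq a hv, TQD.gaugeVar_eq a' hv, ha, ha', h]

/-! ### Time slices -/

lemma inLattice_zero_iff {p : ZMod L × ZMod L × ℕ} {S : Finset (Fin 3)} :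
    InLattice 0 p S ↔ p.2.2 = 0 ∧ 2 ∉ S := by
  unfold InLattice
  constructor
  · exact fun h => ⟨by omega, fun h2 => Nat.not_lt_zero _ (h.2 h2)⟩
  · exact fun h => ⟨by omega, fun h2 => absurd h2 h.2⟩

/-- The vertex at time `t` over a vertex of the square lattice. -/
def liftPos (t : ℕ) (p : ZMod L × ZMod L × ℕ) : ZMod L × ZMod L × ℕ := (p.1, p.2.1, t)

lemma shift_liftPos (t : ℕ) (p : ZMod L × ZMod L × ℕ) {S : Finset (Fin 3)} (hS : 2 ∉ S) :
    shift (liftPos t p) S = liftPos t (shift p S) := by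
  have h := shift_time (liftPos t p) S
  simp only [hS, if_false, add_zero] at h
  exact Prod.ext rfl (Prod.ext rfl h)

lemma shift_liftPos_insert (t : ℕ) (p : ZMod L × ZMod L × ℕ) {S : Finset (Fin 3)} (hS : 2 ∉ S) :
    shift (liftPos t p) (insert 2 S) = liftPos (t + 1) (shift p S) := by
  rw [Finset.insert_eq, ← shift_shift _ (by simpa using hS), ← shift_liftPos _ _ hS]
  simp [liftPos, shift, step]

namespace Cochain

/-- The restriction of a cochain to the cells `tσ` of the slice at time `t`. -/
def slice (t : Fin (T + 1)) (f : Cochain L T) : Cochain L 0 :=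
  ⟨fun p S => if InLattice 0 p S then f.1 (liftPos t p) S else 0, fun _ _ h => if_neg h⟩

/-- The restriction of a cochain to the cells `t⁺σ` between the times `t` and `t + 1`. -/
def prism (t : Fin T) (f : Cochain L T) : Cochain L 0 :=
  ⟨fun p S => if InLattice 0 p S then f.1 (liftPos t p) (insert 2 S) else 0, fun _ _ h => if_neg h⟩

lemma slice_apply (t : Fin (T + 1)) (f : Cochain L T) {p : ZMod L × ZMod L × ℕ}
    {S : Finset (Fin 3)} (h : InLattice 0 p S) : (slice t f).1 p S = f.1 (liftPos t p) S :=
  if_pos h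

lemma prism_apply (t : Fin T) (f : Cochain L T) {p : ZMod L × ZMod L × ℕ}
    {S : Finset (Fin 3)} (h : InLattice 0 p S) :
    (prism t f).1 p S = f.1 (liftPos t p) (insert 2 S) :=
  if_pos h

lemma inLattice_zero_shift {p : ZMod L × ZMod L × ℕ} {S U W : Finset (Fin 3)}
    (h : InLattice 0 p S) (hU : U ⊆ S) (hW : W ⊆ S) : InLattice 0 (shift p U) W := by
  rw [inLattice_zero_iff] at h ⊢
  rw [shift_time, if_neg fun h2 => h.2 (hU h2), h.1]
  exact ⟨rfl, fun h2 => h.2 (hW h2)⟩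

lemma inLattice_zero_mono {p : ZMod L × ZMod L × ℕ} {S U : Finset (Fin 3)}
    (h : InLattice 0 p S) (hU : U ⊆ S) : InLattice 0 p U := by
  rw [inLattice_zero_iff] at h ⊢
  exact ⟨h.1, fun h2 => h.2 (hU h2)⟩

lemma slice_mul (t : Fin (T + 1)) (f g : Cochain L T) :
    slice t (f * g) = slice t f * slice t g := by
  ext p S h
  have h2 := (inLattice_zero_iff.1 h).2
  rw [slice_apply _ _ h, mul_apply, mul_apply]
  refine Finset.sum_congr rfl fun U hU => ?_
  have hU := Finset.mem_powerset.1 hU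
  rw [slice_apply _ _ (inLattice_zero_mono h hU),
    slice_apply _ _ (inLattice_zero_shift h hU Finset.sdiff_subset),
    shift_liftPos _ _ fun h' => h2 (hU h')]

/-- A pair of sequential subcells of a prism is either a cell of the lower slice followed by a
prism, or a prism followed by a cell of the upper slice. -/
lemma prism_mul (t : Fin T) (f g : Cochain L T) :
    prism t (f * g) = slice t.castSucc f * prism t g + prism t f * slice t.succ g := by
  ext p S h
  have h2 := (inLattice_zero_iff.1 h).2
  rw [prism_apply _ _ h, add_apply, mul_apply, mul_apply, mul_apply, Finset.sum_powerset_insert h2]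
  congr 1
  · refine Finset.sum_congr rfl fun U hU => ?_
    have hU := Finset.mem_powerset.1 hU
    have h2U : 2 ∉ U := fun h' => h2 (hU h')
    rw [slice_apply _ _ (inLattice_zero_mono h hU),
      prism_apply _ _ (inLattice_zero_shift h hU Finset.sdiff_subset), Fin.val_castSucc,
      shift_liftPos _ _ h2U, Finset.insert_sdiff_of_notMem _ h2U]
  · refine Finset.sum_congr rfl fun U hU => ?_
    have hU := Finset.mem_powerset.1 hU
    have h2U : 2 ∉ U := fun h' => h2 (hU h')
    rw [prism_apply _ _ (inLattice_zero_mono h hU),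
      slice_apply _ _ (inLattice_zero_shift h hU Finset.sdiff_subset), Fin.val_succ,
      shift_liftPos_insert _ _ h2U, Finset.insert_sdiff_insert, Finset.sdiff_insert_of_notMem h2]

lemma slice_coboundary (t : Fin (T + 1)) (f : Cochain L T) :
    slice t (coboundary f) = coboundary (slice t f) := by
  ext p S h
  have h2 := (inLattice_zero_iff.1 h).2
  rw [slice_apply _ _ h, coboundary_apply _ h,
    coboundary_apply f ⟨t.2, fun h' => absurd h' h2⟩]
  refine Finset.sum_congr rfl fun i hi => ?_
  have hi2 : 2 ∉ ({i} : Finset (Fin 3)) := by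
    rw [Finset.mem_singleton]; rintro rfl; exact h2 hi
  rw [slice_apply _ _ (inLattice_zero_mono h (Finset.erase_subset _ _)),
    slice_apply _ _ (inLattice_zero_shift h (Finset.singleton_subset_iff.2 hi)
      (Finset.erase_subset _ _)), shift_liftPos _ _ hi2]

lemma prism_coboundary (t : Fin T) (f : Cochain L T) :
    prism t (coboundary f) = slice t.castSucc f + slice t.succ f + coboundary (prism t f) := by
  ext p S h
  have h2 := (inLattice_zero_iff.1 h).2
  rw [prism_apply _ _ h, add_apply, add_apply, coboundary_apply _ h,
    coboundary_apply f ⟨by simp only [liftPos]; omega, fun _ => t.2⟩, Finset.sum_insert h2,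
    Finset.erase_insert h2, slice_apply _ _ h, slice_apply _ _ h]
  congr 1
  · rw [← Finset.insert_empty, shift_liftPos_insert _ _ (by simp), shift_empty]
    rfl
  · refine Finset.sum_congr rfl fun i hi => ?_
    have hi2 : 2 ≠ i := by rintro rfl; exact h2 hi
    rw [prism_apply _ _ (inLattice_zero_mono h (Finset.erase_subset _ _)),
      prism_apply _ _ (inLattice_zero_shift h (Finset.singleton_subset_iff.2 hi)
        (Finset.erase_subset _ _)), shift_liftPos _ _ (by simpa using hi2),
      Finset.erase_insert_of_ne hi2]

/-- Summation over the squares of the square lattice. -/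
lemma sum_squares (F : (ZMod L × ZMod L × ℕ) → Finset (Fin 3) → ZMod 2) :
    ∑ x : Cell L 0 2, F x.pos x.axes = ∑ s : ZMod L × ZMod L, F (s.1, s.2, 0) {0, 1} := by
  have hax : ∀ S : Finset (Fin 3), S.card = 2 → 2 ∉ S → S = {0, 1} := by decide
  refine Finset.sum_bij (fun x _ => (x.1.1.1, x.1.1.2.1)) ?_ ?_ ?_ ?_
  · simp
  · rintro x - y - h
    have hx := inLattice_zero_iff.1 x.inLattice
    have hy := inLattice_zero_iff.1 y.inLattice
    refine Cell.ext_pos_axes (Prod.ext ?_ (Prod.ext ?_ (hx.1.trans hy.1.symm)))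
      ((hax _ x.2.1 hx.2).trans (hax _ y.2.1 hy.2).symm)
    · exact (Prod.mk.inj h).1
    · exact (Prod.mk.inj h).2
  · rintro ⟨i, j⟩ -
    have h2 : 2 ∉ ({0, 1} : Finset (Fin 3)) := by decide
    exact ⟨⟨((i, j, 0), {0, 1}), rfl, fun h => absurd h h2⟩, by simp, rfl⟩
  · rintro x -
    have hx := inLattice_zero_iff.1 x.inLattice
    rw [hax x.axes x.2.1 hx.2, show x.pos = (x.1.1.1, x.1.1.2.1, 0) from
      Prod.ext rfl (Prod.ext rfl hx.1)]

lemma integral_three (f : Cochain L T) : integral 3 f = ∑ t : Fin T, integral 2 (prism t f) := by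
  change ∑ x : Cell L T 3, f.1 x.pos x.axes =
    ∑ t : Fin T, ∑ x : Cell L 0 2, (prism t f).1 x.pos x.axes
  rw [sum_cubes, Finset.sum_comm, Finset.sum_range]
  refine Finset.sum_congr rfl fun t _ => ?_
  rw [sum_squares]
  refine Finset.sum_congr rfl fun s _ => ?_
  rw [prism_apply _ _ (inLattice_zero_iff.2 ⟨rfl, by decide⟩)]
  rw [show insert 2 ({0, 1} : Finset (Fin 3)) = Finset.univ by decide]
  rfl

end Cochain

/-- The restriction of a triple of chains to the slice at time `t`. -/
def CChain.slice {k : ℕ} (t : Fin (T + 1)) (a : CChain L T k) : CChain L 0 k :=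
  fun x => a (x.1, atTime t x.2)

/-- The restriction of a triple of chains to the cells between the times `t` and `t + 1`. -/
def CChain.prism {k : ℕ} (t : Fin T) (a : CChain L T (k + 1)) : CChain L 0 k :=
  fun x => a (x.1, overTime t x.2)

lemma CChain.co_slice {k : ℕ} (t : Fin (T + 1)) (a : CChain L T k) (c : Color) :
    (a.slice t).co c = Cochain.slice t (a.co c) := by
  ext p S h
  rw [slice_apply _ _ h]
  by_cases hS : S.card = k
  · obtain ⟨x, rfl, rfl, hx⟩ := ((a.slice t).comp c).val_of_inLattice hS h
    exact hx.trans ((a.comp c).val_pos_axes (atTime t x)).symm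
  · exact (Chain.val_of_card_ne _ _ hS).trans (Chain.val_of_card_ne _ _ hS).symm

lemma CChain.co_prism {k : ℕ} (t : Fin T) (a : CChain L T (k + 1)) (c : Color) :
    (a.prism t).co c = Cochain.prism t (a.co c) := by
  ext p S h
  rw [prism_apply _ _ h]
  by_cases hS : S.card = k
  · obtain ⟨x, rfl, rfl, hx⟩ := ((a.prism t).comp c).val_of_inLattice hS h
    exact hx.trans ((a.comp c).val_pos_axes (overTime t x)).symm
  · refine (Chain.val_of_card_ne _ _ hS).trans (Chain.val_of_card_ne _ _ ?_).symm
    rw [Finset.card_insert_of_notMem (inLattice_zero_iff.1 h).2]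
    omega

lemma CChain.slice_d {k : ℕ} (t : Fin (T + 1)) (a : CChain L T k) :
    (d a).slice t = d (a.slice t) :=
  CChain.co_injective fun c => by
    rw [CChain.co_slice, CChain.co_d, slice_coboundary, CChain.co_d, CChain.co_slice]

lemma CChain.prism_d {k : ℕ} (t : Fin T) (a : CChain L T (k + 1)) :
    (d a).prism t = a.slice t.castSucc + a.slice t.succ + d (a.prism t) :=
  CChain.co_injective fun c => by
    rw [CChain.co_prism, CChain.co_d, prism_coboundary, CChain.co_add, CChain.co_add, CChain.co_d,
      CChain.co_prism, CChain.co_slice, CChain.co_slice]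

/-- The phase exponent of one round of vertex measurements: from the configuration `g` to the
configuration `g'` by the gauge transformation `w`. -/
def roundPhase (g' : CChain L 0 1) (w : CChain L 0 0) (g : CChain L 0 1) : ZMod 2 :=
  cupSum (w.comp .r) (g'.comp .g) (g'.comp .b) + cupSum (g.comp .r) (w.comp .g) (g'.comp .b) +
    cupSum (g.comp .r) (g.comp .g) (w.comp .b)

/-- The action of a history is the sum of the phases of the rounds. -/
lemma action_eq_sum (a : CChain L T 1) :
    action a = ∑ t : Fin T, roundPhase (a.slice t.succ) (a.prism t) (a.slice t.castSucc) := by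
  rw [action_eq, integral₃, integral_three]
  refine Finset.sum_congr rfl fun t _ => ?_
  simp only [roundPhase, cupSum_eq_integral]
  change _ = integral 2 ((a.prism t).co .r * (a.slice t.succ).co .g * (a.slice t.succ).co .b) +
    integral 2 ((a.slice t.castSucc).co .r * (a.prism t).co .g * (a.slice t.succ).co .b) +
    integral 2 ((a.slice t.castSucc).co .r * (a.slice t.castSucc).co .g * (a.prism t).co .b)
  simp only [CChain.co_slice, CChain.co_prism]
  rw [prism_mul, prism_mul, slice_mul, add_mul, map_add, map_add]
  ring

/-- Every cell of positive dimension is either a cell of a time slice or a prism. -/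
def splitCells (L T k : ℕ) :
    (Fin (T + 1) × Cell L 0 (k + 1)) ⊕ (Fin T × Cell L 0 k) ≃ Cell L T (k + 1) :=
  Equiv.ofBijective (Sum.elim (fun x => atTime x.1 x.2) (fun x => overTime x.1 x.2)) (by
    have h2 : ∀ {k : ℕ} (s : Cell L 0 k), 2 ∉ s.1.2 := fun s h => Nat.not_lt_zero _ (s.2.2 h)
    have h0 : ∀ t t' : Fin (0 + 1), t = t' := by decide
    constructor
    · rintro (⟨t, s⟩ | ⟨t, s⟩) (⟨t', s'⟩ | ⟨t', s'⟩) h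
      · simp only [Sum.elim_inl, atTime, Subtype.mk.injEq, Prod.mk.injEq] at h
        have : s = s' := Subtype.ext (Prod.ext (Prod.ext h.1.1 (Prod.ext h.1.2.1
          (h0 _ _))) h.2)
        rw [this, h.1.2.2]
      · simp only [Sum.elim_inl, Sum.elim_inr, atTime, overTime, Subtype.mk.injEq,
          Prod.mk.injEq] at h
        exact absurd (h.2 ▸ Finset.mem_insert_self _ _) (h2 s)
      · simp only [Sum.elim_inl, Sum.elim_inr, atTime, overTime, Subtype.mk.injEq,
          Prod.mk.injEq] at h
        exact absurd (h.2 ▸ Finset.mem_insert_self _ _) (h2 s')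
      · simp only [Sum.elim_inr, overTime, Subtype.mk.injEq, Prod.mk.injEq] at h
        have hS : s.1.2 = s'.1.2 := by
          rw [← Finset.erase_insert (h2 s), ← Finset.erase_insert (h2 s'), h.2]
        have : s = s' := Subtype.ext (Prod.ext (Prod.ext h.1.1 (Prod.ext h.1.2.1
          (h0 _ _))) hS)
        rw [this, Fin.castSucc_injective _ h.1.2.2]
    · rintro ⟨⟨⟨i, j, t⟩, S⟩, h1, h3⟩
      by_cases hS : 2 ∈ S
      · refine ⟨.inr ⟨⟨t, h3 hS⟩, ⟨((i, j, 0), S.erase 2), ?_, by simp⟩⟩, ?_⟩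
        · rw [Finset.card_erase_of_mem hS]
          simp only at h1
          omega
        · refine Subtype.ext (Prod.ext rfl ?_)
          exact Finset.insert_erase hS
      · exact ⟨.inl ⟨t, ⟨((i, j, 0), S), h1, fun h => absurd h hS⟩⟩, rfl⟩)

lemma forall_cells {k : ℕ} (P : Cell L T (k + 1) → Prop) :
    (∀ x, P x) ↔ (∀ t s, P (atTime t s)) ∧ ∀ t s, P (overTime t s) := by
  refine ⟨fun h => ⟨fun _ _ => h _, fun _ _ => h _⟩, fun h x => ?_⟩
  obtain ⟨(y | y), rfl⟩ := (splitCells L T k).surjective x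
  · exact h.1 y.1 y.2
  · exact h.2 y.1 y.2

lemma CChain.eq_iff_slices {k : ℕ} (a b : CChain L T (k + 1)) :
    a = b ↔ (∀ t, a.slice t = b.slice t) ∧ ∀ t, a.prism t = b.prism t := by
  refine ⟨by rintro rfl; simp, fun h => funext fun ⟨c, x⟩ => ?_⟩
  revert x
  rw [forall_cells]
  exact ⟨fun t s => congrFun (h.1 t) (c, s), fun t s => congrFun (h.2 t) (c, s)⟩

lemma dotProduct_eq_sum_slices {k : ℕ} (a b : CChain L T (k + 1)) :
    a ⬝ᵥ b = ∑ t, a.slice t ⬝ᵥ b.slice t + ∑ t, a.prism t ⬝ᵥ b.prism t := by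
  simp only [dotProduct, Fintype.sum_prod_type]
  rw [Finset.sum_comm (γ := Fin (T + 1)), Finset.sum_comm (γ := Fin T), ← Finset.sum_add_distrib]
  refine Finset.sum_congr rfl fun c _ => ?_
  rw [← (splitCells L T k).sum_comp, Fintype.sum_sum_type, Fintype.sum_prod_type,
    Fintype.sum_prod_type]
  rfl

/-- A triple of 1-chains is a history: a sequence of configurations, and the gauge transformations
between them. -/
def historyEquiv (L T : ℕ) [NeZero L] :
    CChain L T 1 ≃ (Fin (T + 1) → CChain L 0 1) × (Fin T → CChain L 0 0) where
  toFun a := (fun t => a.slice t, fun t => a.prism t)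
  invFun h := fun x => Sum.elim (fun y => h.1 y.1 (x.1, y.2)) (fun y => h.2 y.1 (x.1, y.2))
    ((splitCells L T 0).symm x.2)
  left_inv a := by
    funext ⟨c, x⟩
    obtain ⟨(y | y), rfl⟩ := (splitCells L T 0).surjective x <;>
    · simp only [Equiv.symm_apply_apply]
      rfl
  right_inv h := by
    refine Prod.ext (funext fun t => funext fun x => ?_) (funext fun t => funext fun x => ?_)
    · change Sum.elim _ _ ((splitCells L T 0).symm (splitCells L T 0 (.inl (t, x.2)))) = _
      rw [Equiv.symm_apply_apply]; rfl
    · change Sum.elim _ _ ((splitCells L T 0).symm (splitCells L T 0 (.inr (t, x.2)))) = _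
      rw [Equiv.symm_apply_apply]; rfl

/-- If the flux is conserved in the last time step, a history that sees the right flux before the
final time also does so at the final time. -/
lemma d_eq_iff [NeZero T] {b : CChain L T 2}
    (hb : ∀ (c : Color) (x : Cell L T 3), x.time + 1 = T → d b (c, x) = 0) (a : CChain L T 1) :
    d a = b ↔ ∀ t : Fin T, d (a.slice t.castSucc) = b.slice t.castSucc ∧
      a.slice t.succ = a.slice t.castSucc + d (a.prism t) + b.prism t := by
  have h2 : ∀ {k : ℕ} (f g h e : CChain L 0 k), f + g + h = e ↔ g = f + h + e := by
    intro k f g h e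
    have hz : ∀ z : CChain L 0 k, z + z = 0 := fun z => funext fun _ => CharTwo.add_self_eq_zero _
    constructor
    · rintro rfl
      rw [show f + h + (f + g + h) = (f + f) + (h + h) + g by abel, hz, hz, zero_add, zero_add]
    · rintro rfl
      rw [show f + (f + h + e) + h = (f + f) + (h + h) + e by abel, hz, hz, zero_add, zero_add]
  rw [CChain.eq_iff_slices]
  simp only [CChain.slice_d, CChain.prism_d, h2]
  refine ⟨fun h t => ⟨h.1 _, h.2 t⟩, fun h => ⟨fun t => ?_, fun t => (h t).2⟩⟩
  -- On the faces at time `T`, conservation of the flux in the last time step decides.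
  rcases Fin.eq_castSucc_or_eq_last t with ⟨t, rfl⟩ | rfl
  · exact (h t).1
  obtain ⟨n, rfl⟩ := Nat.exists_eq_succ_of_ne_zero (NeZero.ne T)
  have h0 : (d b).prism (Fin.last n) = 0 := by
    funext x
    exact hb x.1 (overTime (Fin.last n) x.2) rfl
  rw [CChain.prism_d, ← (h (Fin.last n)).1] at h0
  have h1 := (h (Fin.last n)).2
  rw [Fin.succ_last] at h0 h1
  have hz : ∀ z : CChain L 0 2, z + z = 0 := fun z => funext fun _ => CharTwo.add_self_eq_zero _
  rw [h1, d_add, d_add, d_d, add_zero]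
  rw [show d (a.slice (Fin.last n).castSucc) + d (b.prism (Fin.last n)) =
    (d (a.slice (Fin.last n).castSucc) + b.slice (Fin.last (n + 1)) + d (b.prism (Fin.last n))) +
      b.slice (Fin.last (n + 1)) + (-b.slice (Fin.last (n + 1)) - b.slice (Fin.last (n + 1)))
    by abel, h0, zero_add, ← neg_add', hz, neg_zero, add_zero]

/-! ### The circuit as a sum over histories -/

lemma sgn_zero : sgn 0 = 1 := if_pos rfl

lemma sgn_add (s t : ZMod 2) : sgn (s + t) = sgn s * sgn t := by
  revert s t
  have h : ∀ s : ZMod 2, s = 0 ∨ s = 1 := by decide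
  intro s t
  have h11 : (1 + 1 : ZMod 2) = 0 := by decide
  rcases h s with rfl | rfl <;> rcases h t with rfl | rfl <;> simp [sgn, h11]

lemma sgn_sum {ι : Type*} (s : Finset ι) (f : ι → ZMod 2) :
    sgn (∑ i ∈ s, f i) = ∏ i ∈ s, sgn (f i) := by
  classical
  induction s using Finset.induction_on with
  | empty => simp [sgn_zero]
  | insert i s hi ih => rw [Finset.sum_insert hi, Finset.prod_insert hi, sgn_add, ih]

lemma sgn_eq (s : ZMod 2) : sgn s = 1 ∨ sgn s = -1 := by
  unfold sgn; split_ifs <;> simp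

lemma diagOp_apply (f : Config L → ℂ) (ψ : Config L → ℂ) (g : Config L) :
    diagOp f ψ g = f g * ψ g := rfl

lemma shiftOp_apply (h : Config L) (ψ : Config L → ℂ) (g : Config L) :
    shiftOp h ψ g = ψ (g - h) := rfl

lemma diagOp_mul (f f' : Config L → ℂ) : diagOp f * diagOp f' = diagOp fun g => f g * f' g :=
  LinearMap.ext fun ψ => funext fun g => (mul_assoc (f g) (f' g) (ψ g)).symm

lemma diagOp_one : diagOp (fun _ : Config L => 1) = 1 :=
  LinearMap.ext fun ψ => funext fun g => one_mul (ψ g)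

lemma shiftOp_zero : shiftOp (0 : Config L) = 1 :=
  LinearMap.ext fun ψ => funext fun g => by rw [shiftOp_apply, sub_zero]; rfl

/-- The triple of chains with a single non-zero colour. -/
def ofColor {k : ℕ} (c : Color) : Chain L T k →+ CChain L T k where
  toFun u := fun x => if x.1 = c then u x.2 else 0
  map_zero' := by ext; simp
  map_add' u u' := by ext x; by_cases h : x.1 = c <;> simp [h]

lemma comp_ofColor {k : ℕ} (c : Color) (u : Chain L T k) : (ofColor c u).comp c = u := by
  funext x; simp [CChain.comp, ofColor]

lemma comp_ofColor_of_ne {k : ℕ} {c c' : Color} (h : c' ≠ c) (u : Chain L T k) :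
    (ofColor c u).comp c' = 0 := by
  funext x; simp [CChain.comp, ofColor, h]

lemma ofColor_single {k : ℕ} (c : Color) (x : Cell L T k) (z : ZMod 2) :
    ofColor c (Pi.single x z) = Pi.single (c, x) z := by
  funext ⟨c', y⟩
  by_cases h : c' = c
  · subst h
    by_cases hy : y = x
    · subst hy; simp [ofColor]
    · simp [ofColor, hy]
  · simp [ofColor, h]

lemma comp_d {k : ℕ} (a : CChain L T k) (c : Color) : (d a).comp c = dMat L T k *ᵥ a.comp c := rfl

lemma comp_sub {k : ℕ} (a b : CChain L T k) (c : Color) :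
    (a - b).comp c = a.comp c - b.comp c := rfl

lemma d_ofColor {k : ℕ} (c : Color) (u : Chain L T k) :
    d (ofColor c u) = ofColor c (dMat L T k *ᵥ u) := by
  funext ⟨c', x⟩
  change ((d (ofColor c u)).comp c') x = ((ofColor c (dMat L T k *ᵥ u)).comp c') x
  rw [comp_d]
  by_cases h : c' = c
  · subst h; rw [comp_ofColor, comp_ofColor]
  · rw [comp_ofColor_of_ne h, comp_ofColor_of_ne h, Matrix.mulVec_zero]

/-- The phase exponent of a product of vertex stabilizers of one colour, for the set of vertices
with characteristic function `u`. -/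
def gaugePhase (c : Color) (u : Chain L 0 0) (a : Config L) : ZMod 2 :=
  match c with
  | .r => cupSum u (a.comp .g) (a.comp .b)
  | .g => cupSum (a.comp .r) u (a.comp .b)
  | .b => cupSum (a.comp .r) (a.comp .g) u

lemma gaugePhase_add (c : Color) (u u' : Chain L 0 0) (a : Config L) :
    gaugePhase c (u + u') a = gaugePhase c u a + gaugePhase c u' a := by
  cases c <;> simp only [gaugePhase, cupSum_eq_integral, map_add, mul_add, add_mul]

lemma gaugePhase_zero (c : Color) (a : Config L) : gaugePhase c 0 a = 0 := by
  cases c <;> simp [gaugePhase, cupSum_eq_integral]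

lemma gaugePhase_sub_ofColor (c : Color) (u : Chain L 0 0) (a : Config L) (x : Chain L 0 1) :
    gaugePhase c u (a - ofColor c x) = gaugePhase c u a := by
  cases c <;> simp [gaugePhase, comp_sub, comp_ofColor_of_ne]

/-- The product of the vertex stabilizers of one colour, for the set of vertices with characteristic
function `u`. -/
def gaugeOp (c : Color) (u : Chain L 0 0) : Op L :=
  shiftOp (d (ofColor c u)) * diagOp fun a => sgn (gaugePhase c u a)

lemma gaugeOp_apply (c : Color) (u : Chain L 0 0) (ψ : Config L → ℂ) (g : Config L) :
    gaugeOp c u ψ g = sgn (gaugePhase c u g) * ψ (g - d (ofColor c u)) := by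
  change sgn (gaugePhase c u (g - d (ofColor c u))) * ψ (g - d (ofColor c u)) = _
  rw [d_ofColor, gaugePhase_sub_ofColor]

lemma gaugeOp_single (c : Color) (v : Cell L 0 0) : gaugeOp c (Pi.single v 1) = A c v := by
  rw [gaugeOp, A, ofColor_single]
  cases c <;> rfl

lemma gaugeOp_zero (c : Color) : gaugeOp c (0 : Chain L 0 0) = 1 := by
  refine LinearMap.ext fun ψ => funext fun g => ?_
  rw [gaugeOp_apply, gaugePhase_zero, d_ofColor, Matrix.mulVec_zero, map_zero, sgn_zero, one_mul,
    sub_zero]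
  rfl

lemma gaugeOp_mul (c : Color) (u u' : Chain L 0 0) :
    gaugeOp c u * gaugeOp c u' = gaugeOp c (u + u') := by
  refine LinearMap.ext fun ψ => funext fun g => ?_
  rw [Module.End.mul_apply, gaugeOp_apply, gaugeOp_apply, gaugeOp_apply, gaugePhase_add, sgn_add,
    d_ofColor c u, gaugePhase_sub_ofColor, map_add, d_add, d_ofColor c u, ← sub_sub, mul_assoc]

/-- The characteristic function of a finite set, with values in `ZMod 2`. -/
def indicator {ι : Type} [DecidableEq ι] (U : Finset ι) : ι → ZMod 2 :=
  fun i => if i ∈ U then 1 else 0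

lemma indicator_insert {ι : Type} [DecidableEq ι] {U : Finset ι} {i : ι} (hi : i ∉ U) :
    indicator (insert i U) = Pi.single i 1 + indicator U := by
  funext j
  by_cases h : j = i
  · subst h; simp [indicator, hi]
  · simp [indicator, h]

/-- Subsets correspond to `ZMod 2`-valued functions. -/
lemma sum_powerset_indicator {ι : Type} [Fintype ι] [DecidableEq ι] {E : Type*} [AddCommMonoid E]
    (F : (ι → ZMod 2) → E) :
    ∑ U ∈ (Finset.univ : Finset ι).powerset, F (indicator U) = ∑ u, F u := by
  refine Finset.sum_bij' (fun U _ => indicator U) (fun u _ => Finset.univ.filter fun i => u i = 1)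
    (by simp) (by simp) ?_ ?_ (by simp)
  · intro U _
    ext i; simp [indicator]
  · intro u _
    funext i
    have h : ∀ s : ZMod 2, (if s = 1 then (1 : ZMod 2) else 0) = s := by decide
    simpa [indicator] using h (u i)

/-- The product of the projectors is a signed average over the products of stabilizers. The
commutation proof of the noncommutative product is a variable here, for any set of vertices. -/
lemma prod_projA (c : Color) (σ : Cell L 0 0 → ZMod 2) (s : Finset (Cell L 0 0))
    (comm : (s : Set (Cell L 0 0)).Pairwise (Function.onFun Commute fun v => projA c v (σ v))) :
    s.noncommProd (fun v : Cell L 0 0 => projA c v (σ v)) comm =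
    (1 / 2 : ℂ) ^ s.card •
      ∑ U ∈ s.powerset, sgn (indicator U ⬝ᵥ σ) • gaugeOp c (indicator U) := by
  induction s using Finset.induction_on with
  | empty =>
    have h : indicator (∅ : Finset (Cell L 0 0)) = 0 := by funext i; simp [indicator]
    simp [h, gaugeOp_zero, sgn_zero]
  | insert v s hv ih =>
    rw [Finset.noncommProd_insert_of_notMem _ _ _ _ hv, ih, Finset.sum_powerset_insert hv,
      Finset.card_insert_of_notMem hv, pow_succ', mul_smul, projA, smul_mul_smul_comm, add_mul,
      one_mul, smul_mul_assoc, Finset.mul_sum, Finset.smul_sum]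
    rw [smul_smul]
    congr 2
    refine Finset.sum_congr rfl fun U hU => ?_
    have hvU : v ∉ U := fun h => hv (Finset.mem_powerset.1 hU h)
    rw [indicator_insert hvU, add_dotProduct, sgn_add, ← gaugeOp_mul, gaugeOp_single,
      single_one_dotProduct, mul_smul_comm, smul_smul]

lemma X_pow (c : Color) (e : Cell L 0 1) (z : ZMod 2) :
    X c e ^ z.val = shiftOp (Pi.single (c, e) z) := by
  have h : z = 0 ∨ z = 1 := by revert z; decide
  rcases h with rfl | rfl
  · rw [Pi.single_zero, shiftOp_zero]; exact pow_zero _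
  · exact pow_one _

lemma Z_pow (c : Color) (e : Cell L 0 1) (z : ZMod 2) :
    Z c e ^ z.val = diagOp fun g => sgn (z * g (c, e)) := by
  have h : z = 0 ∨ z = 1 := by revert z; decide
  rcases h with rfl | rfl
  · simp only [zero_mul, sgn_zero, diagOp_one]; exact pow_zero _
  · simp only [one_mul]; exact pow_one _

/-- The Pauli operators of one round and colour: first all the `Z`, then all the `X`. These may be
separated because operators on different edges commute. -/
lemma prod_XZ (c : Color) (β σ : Chain L 0 1)
    (comm : ((Finset.univ : Finset (Cell L 0 1)) : Set (Cell L 0 1)).Pairwise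
      (Function.onFun Commute fun e => X c e ^ (β e).val * Z c e ^ (σ e).val)) :
    Finset.univ.noncommProd (fun e : Cell L 0 1 => X c e ^ (β e).val * Z c e ^ (σ e).val) comm =
    shiftOp (ofColor c β) * diagOp fun g => sgn (σ ⬝ᵥ g.comp c) := by
  have key : ∀ (s : Finset (Cell L 0 1)) (comm : (s : Set (Cell L 0 1)).Pairwise
      (Function.onFun Commute fun e => X c e ^ (β e).val * Z c e ^ (σ e).val)),
      s.noncommProd (fun e : Cell L 0 1 => X c e ^ (β e).val * Z c e ^ (σ e).val) comm =
      shiftOp (∑ e ∈ s, Pi.single (c, e) (β e)) *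
        diagOp fun g => sgn (∑ e ∈ s, σ e * g (c, e)) := by
    intro s comm
    induction s using Finset.induction_on with
    | empty =>
      rw [Finset.noncommProd_empty]
      simp only [Finset.sum_empty, sgn_zero, shiftOp_zero, diagOp_one, one_mul]
    | insert e s he ih =>
      rw [Finset.noncommProd_insert_of_notMem _ _ _ _ he, ih, X_pow, Z_pow]
      refine LinearMap.ext fun ψ => funext fun g => ?_
      simp only [Module.End.mul_apply, shiftOp_apply, diagOp_apply]
      have h0 : (∑ e' ∈ s, Pi.single (c, e') (β e') : Config L) (c, e) = 0 := by
        rw [Finset.sum_apply]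
        refine Finset.sum_eq_zero fun e' he' => Pi.single_eq_of_ne ?_ _
        rintro h
        exact he ((Prod.mk.inj h).2 ▸ he')
      rw [Finset.sum_insert he, sub_sub, ← mul_assoc, ← sgn_add, Finset.sum_insert he]
      simp only [Pi.sub_apply, Pi.add_apply, h0, add_zero]
  rw [key]
  congr 2
  simp only [← ofColor_single, ← map_sum, Finset.univ_sum_single]

lemma B_eq (c : Color) (f : Cell L 0 2) : B c f = diagOp fun g => sgn (d g (c, f)) := by
  unfold B
  congr 1
  funext g
  rw [← sgn_sum, Finset.sum_filter]
  congr 1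
  refine Finset.sum_congr rfl fun e _ => ?_
  have h : ∀ s t : ZMod 2, (if s = 1 then t else 0) = s * t := by decide
  exact h _ _

lemma projB_eq (c : Color) (f : Cell L 0 2) (s : ZMod 2) :
    projB c f s = diagOp fun g => if d g (c, f) = s then 1 else 0 := by
  have h : ∀ s t : ZMod 2, (1 / 2 : ℂ) * (1 + sgn s * sgn t) = if t = s then 1 else 0 := by
    intro s t
    have h : ∀ s : ZMod 2, s = 0 ∨ s = 1 := by decide
    rcases h s with rfl | rfl <;> rcases h t with rfl | rfl <;> norm_num [sgn]
  refine LinearMap.ext fun ψ => funext fun g => ?_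
  rw [projB, B_eq, diagOp_apply, ← h]
  simp [diagOp_apply]
  ring

lemma ite_mul_ite {P Q R : Prop} [Decidable P] [Decidable Q] [Decidable R] (h : R ↔ P ∧ Q) :
    ((if P then 1 else 0) * if Q then 1 else 0 : ℂ) = if R then 1 else 0 := by
  by_cases hP : P <;> by_cases hQ : Q <;> simp [h, hP, hQ]

/-- The plaquette projectors of one round and colour project onto the configurations with the given
flux. -/
lemma prod_projB (c : Color) (β : Cell L 0 2 → ZMod 2)
    (comm : ((Finset.univ : Finset (Cell L 0 2)) : Set (Cell L 0 2)).Pairwise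
      (Function.onFun Commute fun f => projB c f (β f))) :
    Finset.univ.noncommProd (fun f : Cell L 0 2 => projB c f (β f)) comm =
    diagOp fun g => if dMat L 0 1 *ᵥ g.comp c = β then 1 else 0 := by
  have key : ∀ (s : Finset (Cell L 0 2)) (comm : (s : Set (Cell L 0 2)).Pairwise
      (Function.onFun Commute fun f => projB c f (β f))),
      s.noncommProd (fun f : Cell L 0 2 => projB c f (β f)) comm =
      diagOp fun g => if ∀ f ∈ s, d g (c, f) = β f then 1 else 0 := by
    intro s comm
    induction s using Finset.induction_on with
    | empty => simp [diagOp_one]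
    | insert f s hf ih =>
      rw [Finset.noncommProd_insert_of_notMem _ _ _ _ hf, ih, projB_eq, diagOp_mul]
      congr 1
      funext g
      exact ite_mul_ite (Finset.forall_mem_insert f s fun f => d g (c, f) = β f)
  rw [key]
  congr 1
  funext g
  simp only [Finset.mem_univ, true_implies, funext_iff]
  rfl

/-- The normalization of one colour in one round. -/
def stepNorm (L : ℕ) [NeZero L] : ℂ := (1 / 2 : ℂ) ^ Fintype.card (Cell L 0 0)

/-- The amplitude for one colour in one round, for the gauge transformation `u` and the
configurations `g'` after and `g` before. -/
def stepAmp (b : CChain L T 2) (q : CChain L T 1) (t : Fin T) (c : Color)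
    (g' : Config L) (u : Chain L 0 0) (g : Config L) : ℂ :=
  if dMat L 0 1 *ᵥ g.comp c = (b.slice t.castSucc).comp c then
    sgn (u ⬝ᵥ (q.prism t).comp c + gaugePhase c u g' + (q.slice t.castSucc).comp c ⬝ᵥ g.comp c)
  else 0

lemma colorStep_apply (b : CChain L T 2) (q : CChain L T 1) (t : Fin T) (c : Color)
    (ψ : Config L → ℂ) (g : Config L) :
    colorStep b q t c ψ g = stepNorm L * ∑ u : Chain L 0 0,
      stepAmp b q t c g u (g - (d (ofColor c u) + ofColor c ((b.prism t).comp c))) *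
        ψ (g - (d (ofColor c u) + ofColor c ((b.prism t).comp c))) := by
  have e : colorStep b q t c = (stepNorm L • ∑ u : Chain L 0 0,
      sgn (u ⬝ᵥ (q.prism t).comp c) • gaugeOp c u) *
      (shiftOp (ofColor c ((b.prism t).comp c)) *
        diagOp fun g => sgn ((q.slice t.castSucc).comp c ⬝ᵥ g.comp c)) *
      diagOp fun g => if dMat L 0 1 *ᵥ g.comp c = (b.slice t.castSucc).comp c then 1 else 0 := by
    rw [stepNorm, ← Finset.card_univ,
      ← sum_powerset_indicator fun u => sgn (u ⬝ᵥ (q.prism t).comp c) • gaugeOp c u]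
    exact congrArg₂ _ (congrArg₂ _
      (prod_projA c (fun v => q (c, overTime t v)) _ fun _ _ _ _ _ => projA_commute _ _ _ _ _)
      (prod_XZ c (fun e => b (c, overTime t e)) (fun e => q (c, atTime t.castSucc e))
        fun _ _ _ _ h => XZ_pow_commute _ _ _ h _ _ _ _))
      (prod_projB c (fun f => b (c, atTime t.castSucc f)) fun _ _ _ _ _ =>
        projB_commute _ _ _ _ _)
  rw [e]
  rw [Module.End.mul_apply, Module.End.mul_apply, Module.End.mul_apply]
  rw [LinearMap.smul_apply, LinearMap.sum_apply, Pi.smul_apply,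
    Finset.sum_apply, smul_eq_mul]
  refine congrArg (stepNorm L * ·) (Finset.sum_congr rfl fun u _ => ?_)
  rw [LinearMap.smul_apply, Pi.smul_apply, smul_eq_mul, gaugeOp_apply, shiftOp_apply, diagOp_apply,
    diagOp_apply, sub_sub]
  generalize g - (d (ofColor c u) + ofColor c ((b.prism t).comp c)) = g₀
  unfold stepAmp
  split_ifs
  · rw [sgn_add, sgn_add]; ring
  · ring

-- Shortcuts: the search for these instances is too long for the default limits.
set_option synthInstance.maxHeartbeats 200000 in
instance {k : ℕ} : Fintype (CChain L T k) := Pi.instFintype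

instance {k : ℕ} : Fintype (Chain L T k) := Pi.instFintype

lemma Color.sum_univ {E : Type*} [AddCommMonoid E] (F : Color → E) :
    ∑ c, F c = F .r + (F .g + F .b) := by
  have h : (Finset.univ : Finset Color) = {.r, .g, .b} := rfl
  rw [h, Finset.sum_insert (by decide), Finset.sum_pair (by decide)]

lemma CChain.ext_comp {k : ℕ} {a b : CChain L T k} (h : ∀ c, a.comp c = b.comp c) : a = b :=
  funext fun x => congrFun (h x.1) x.2

lemma dotProduct_eq_sum_comp {k : ℕ} (a b : CChain L T k) :
    a ⬝ᵥ b = a.comp .r ⬝ᵥ b.comp .r + (a.comp .g ⬝ᵥ b.comp .g + a.comp .b ⬝ᵥ b.comp .b) := by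
  rw [← Color.sum_univ fun c => a.comp c ⬝ᵥ b.comp c]
  simp only [dotProduct, Fintype.sum_prod_type]
  rfl

/-- A triple of chains as three chains. -/
def compEquiv (L T k : ℕ) :
    CChain L T k ≃ Chain L T k × Chain L T k × Chain L T k where
  toFun a := (a.comp .r, a.comp .g, a.comp .b)
  invFun u := fun x => match x.1 with
    | .r => u.1 x.2
    | .g => u.2.1 x.2
    | .b => u.2.2 x.2
  left_inv a := by
    funext ⟨c, x⟩
    cases c <;> rfl
  right_inv u := rfl

lemma comp_sub_ofColor {k : ℕ} (g : CChain L T k) (c : Color) (z : Chain L T k) :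
    (g - ofColor c z).comp c = g.comp c - z := by
  rw [comp_sub, comp_ofColor]

lemma comp_sub_ofColor_of_ne {k : ℕ} (g : CChain L T k) {c c' : Color} (h : c' ≠ c)
    (z : Chain L T k) : (g - ofColor c z).comp c' = g.comp c' := by
  rw [comp_sub, comp_ofColor_of_ne h, sub_zero]

/-- The amplitude of one round, for the gauge transformation `w` and the configurations `g'` after
and `g` before. -/
def roundAmp (b : CChain L T 2) (q : CChain L T 1) (t : Fin T)
    (g' : Config L) (w : CChain L 0 0) (g : Config L) : ℂ :=
  if d g = b.slice t.castSucc then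
    sgn (q.prism t ⬝ᵥ w + roundPhase g' w g + q.slice t.castSucc ⬝ᵥ g)
  else 0

/-- Each colour step only changes its own colour, so that the red vertex measurements see the green
and blue configurations after the round, the green ones the red configuration before and the blue
one after the round, and the blue ones the red and green configurations before the round. -/
lemma round_apply (b : CChain L T 2) (q : CChain L T 1) (t : Fin T) (ψ : Config L → ℂ)
    (g' : Config L) :
    round b q t ψ g' = ∑ w : CChain L 0 0, stepNorm L ^ 3 *
      roundAmp b q t g' w (g' - (d w + b.prism t)) * ψ (g' - (d w + b.prism t)) := by
  rw [← (compEquiv L 0 0).symm.sum_comp, Fintype.sum_prod_type]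
  simp only [Fintype.sum_prod_type, round, Module.End.mul_apply, colorStep_apply, Finset.mul_sum]
  refine Finset.sum_congr rfl fun ur _ => Finset.sum_congr rfl fun ug _ =>
    Finset.sum_congr rfl fun ub _ => ?_
  -- `g` is the configuration before the round, `g'` the one after it. The configurations in between
  -- agree with one of them in each colour.
  set w := (compEquiv L 0 0).symm (ur, ug, ub) with hw
  have hwr : w.comp .r = ur := rfl
  have hwg : w.comp .g = ug := rfl
  have hwb : w.comp .b = ub := rfl
  simp only [d_ofColor, ← map_add]
  set zr := dMat L 0 0 *ᵥ ur + (b.prism t).comp .r with hzr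
  set zg := dMat L 0 0 *ᵥ ug + (b.prism t).comp .g with hzg
  set zb := dMat L 0 0 *ᵥ ub + (b.prism t).comp .b with hzb
  have hg : g' - (d w + b.prism t) = g' - ofColor .r zr - ofColor .g zg - ofColor .b zb := by
    refine CChain.ext_comp fun c => ?_
    have hc : (g' - (d w + b.prism t)).comp c =
        g'.comp c - (dMat L 0 0 *ᵥ w.comp c + (b.prism t).comp c) := rfl
    rw [hc]
    cases c
    · rw [comp_sub_ofColor_of_ne _ (by decide), comp_sub_ofColor_of_ne _ (by decide),
        comp_sub_ofColor, hwr]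
    · rw [comp_sub_ofColor_of_ne _ (by decide), comp_sub_ofColor,
        comp_sub_ofColor_of_ne _ (by decide), hwg]
    · rw [comp_sub_ofColor, comp_sub_ofColor_of_ne _ (by decide),
        comp_sub_ofColor_of_ne _ (by decide), hwb]
  rw [hg]
  set g := g' - ofColor .r zr - ofColor .g zg - ofColor .b zb with hgdef
  have h1r : (g' - ofColor .r zr).comp .r = g.comp .r := by
    rw [hgdef, comp_sub_ofColor_of_ne (g' - ofColor .r zr - ofColor .g zg) (by decide),
      comp_sub_ofColor_of_ne (g' - ofColor .r zr) (by decide)]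
  have h1b : (g' - ofColor .r zr).comp .b = g'.comp .b := comp_sub_ofColor_of_ne _ (by decide) _
  have h2r : (g' - ofColor .r zr - ofColor .g zg).comp .r = g.comp .r := by
    rw [hgdef, comp_sub_ofColor_of_ne (g' - ofColor .r zr - ofColor .g zg) (by decide)]
  have h2g : (g' - ofColor .r zr - ofColor .g zg).comp .g = g.comp .g := by
    rw [hgdef, comp_sub_ofColor_of_ne (g' - ofColor .r zr - ofColor .g zg) (by decide)]
  have hd : d g = b.slice t.castSucc ↔
      dMat L 0 1 *ᵥ g.comp .r = (b.slice t.castSucc).comp .r ∧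
      dMat L 0 1 *ᵥ g.comp .g = (b.slice t.castSucc).comp .g ∧
      dMat L 0 1 *ᵥ g.comp .b = (b.slice t.castSucc).comp .b := by
    refine ⟨fun h => by rw [← h]; exact ⟨rfl, rfl, rfl⟩, fun h => CChain.ext_comp fun c => ?_⟩
    cases c
    · exact h.1
    · exact h.2.1
    · exact h.2.2
  simp only [stepAmp, roundAmp, gaugePhase, roundPhase, h1r, h1b, h2r, h2g, hd,
    dotProduct_eq_sum_comp, hwr, hwg, hwb, dotProduct_comm ((q.prism t).comp _)]
  by_cases hr : dMat L 0 1 *ᵥ g.comp .r = (b.slice t.castSucc).comp .r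
  · by_cases hg : dMat L 0 1 *ᵥ g.comp .g = (b.slice t.castSucc).comp .g
    · by_cases hb : dMat L 0 1 *ᵥ g.comp .b = (b.slice t.castSucc).comp .b
      · simp only [hr, hg, hb, and_self, if_true, sgn_add]
        ring
      · simp [hb]
    · simp [hg]
  · simp [hr]

/-- The product of operators with given kernels, as a sum over histories. The kernels depend on an
additional variable at each step, which is summed over. -/
lemma prod_ofFn_reverse_apply {X U : Type} [Fintype X] [DecidableEq X] [Fintype U] (n : ℕ)
    (R : Fin n → Module.End ℂ (X → ℂ)) (k : Fin n → X → U → X → ℂ)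
    (hk : ∀ t ψ x', R t ψ x' = ∑ u, ∑ x, k t x' u x * ψ x) (ψ : X → ℂ) (x' : X) :
    (List.ofFn R).reverse.prod ψ x' =
      ∑ g : Fin (n + 1) → X, ∑ u : Fin n → U, if g (Fin.last n) = x' then
        (∏ t, k t (g t.succ) (u t) (g t.castSucc)) * ψ (g 0) else 0 := by
  induction n generalizing ψ with
  | zero =>
    rw [← (Equiv.funUnique (Fin 1) X).symm.sum_comp]
    simp
  | succ n ih =>
    -- The operator that acts first is split off, and with it the start of the history.
    rw [List.ofFn_succ, List.reverse_cons, List.prod_append, List.prod_singleton,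
      Module.End.mul_apply, ih _ (fun t => k t.succ) (fun t => hk t.succ)]
    rw [← (Fin.consEquiv fun _ : Fin (n + 2) => X).sum_comp, Fintype.sum_prod_type_right]
    refine Finset.sum_congr rfl fun g _ => ?_
    simp only [← (Fin.consEquiv fun _ : Fin (n + 1) => U).sum_comp, Fintype.sum_prod_type]
    have hlast : ∀ x : X, (Fin.cons x g : Fin (n + 2) → X) (Fin.last (n + 1)) = g (Fin.last n) :=
      fun x => rfl
    by_cases hx : g (Fin.last n) = x'
    · simp only [Fin.consEquiv_apply, Fin.prod_univ_succ, Fin.cons_zero, Fin.cons_succ, hk, hlast,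
        hx, if_true, Finset.mul_sum]
      rw [Finset.sum_comm, Finset.sum_comm (γ := X)]
      refine Finset.sum_congr rfl fun u₀ _ => ?_
      rw [Finset.sum_comm]
      refine Finset.sum_congr rfl fun x _ => Finset.sum_congr rfl fun u _ => ?_
      have hcs : ∀ t : Fin n, (Fin.cons x g : Fin (n + 2) → X) t.succ.castSucc = g t.castSucc :=
        fun t => rfl
      have hc0 : (Fin.cons x g : Fin (n + 2) → X) (Fin.castSucc 0) = x := rfl
      simp only [hcs, hc0]
      ring
    · simp [hlast, hx]

/-- The sum of the amplitudes of all histories with flux `b` that end in the configuration `g`. -/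
def pathSum (b : CChain L T 2) (q : CChain L T 1) (ψ : Config L → ℂ) (g : Config L) : ℂ :=
  ∑ a : CChain L T 1, if a.slice (Fin.last T) = g ∧ d a = b then
    sgn (q ⬝ᵥ a + action a) * ψ (a.slice 0) else 0

/-- The circuit as a sum over histories. The charges on the edges at the final time, which the
circuit does not read, are removed by the sign in front. -/
lemma circuit_apply [NeZero T] {b : CChain L T 2}
    (hb : ∀ (c : Color) (x : Cell L T 3), x.time + 1 = T → d b (c, x) = 0) (q : CChain L T 1)
    (ψ : Config L → ℂ) (g : Config L) :
    circuit b q ψ g =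
      (stepNorm L ^ 3) ^ T * (sgn (q.slice (Fin.last T) ⬝ᵥ g) * pathSum b q ψ g) := by
  have hk : ∀ t ψ x', round b q t ψ x' = ∑ w : CChain L 0 0, ∑ x : Config L,
      (if d x = b.slice t.castSucc ∧ x' = x + d w + b.prism t then
        stepNorm L ^ 3 * sgn (q.prism t ⬝ᵥ w + roundPhase x' w x + q.slice t.castSucc ⬝ᵥ x)
        else 0) * ψ x := by
    intro t ψ x'
    rw [round_apply]
    refine Finset.sum_congr rfl fun w _ => ?_
    rw [Finset.sum_eq_single (x' - (d w + b.prism t))]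
    · have h : x' = x' - (d w + b.prism t) + d w + b.prism t := by abel
      simp only [roundAmp, ← h, and_true, mul_ite, mul_zero]
    · intro x _ hx
      rw [if_neg, zero_mul]
      rintro ⟨-, h⟩
      exact hx (by rw [h]; abel)
    · simp
  rw [circuit, prod_ofFn_reverse_apply T _ _ hk, pathSum, ← Fintype.sum_prod_type',
    ← (historyEquiv L T).sum_comp, Finset.mul_sum, Finset.mul_sum]
  refine Finset.sum_congr rfl fun a _ => ?_
  have h1 : ∀ t, (historyEquiv L T a).1 t = a.slice t := fun _ => rfl
  have h2 : ∀ t, (historyEquiv L T a).2 t = a.prism t := fun _ => rfl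
  simp only [h1, h2, Finset.prod_ite_zero, Finset.mem_univ, true_implies]
  by_cases hg : a.slice (Fin.last T) = g
  · by_cases ha : d a = b
    · rw [if_pos hg, if_pos ((d_eq_iff hb a).1 ha), if_pos ⟨hg, ha⟩, Finset.prod_mul_distrib,
        Finset.prod_const, Finset.card_univ, Fintype.card_fin, ← sgn_sum, mul_assoc, ← hg,
        ← mul_assoc (sgn _), ← sgn_add, dotProduct_eq_sum_slices q a, Fin.sum_univ_castSucc,
        action_eq_sum, Finset.sum_add_distrib, Finset.sum_add_distrib]
      -- The term of the final edges occurs twice, in the sign in front and in `⟨q, a⟩`.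
      congr 3
      linear_combination -(q.slice (Fin.last T) ⬝ᵥ a.slice (Fin.last T)) *
        (CharTwo.two_eq_zero : (2 : ZMod 2) = 0)
    · rw [if_pos hg, if_neg fun h => ha ((d_eq_iff hb a).2 h), if_neg fun h => ha h.2]
      simp
  · rw [if_neg hg, if_neg fun h => hg h.1]
    simp

/-! ### Gauge transformations of histories -/

lemma slice_d_eq_zero {v : CChain L T 0} (hv : v ∈ interior L T) {t : Fin (T + 1)}
    (ht : (t : ℕ) = 0 ∨ (t : ℕ) = T) : (d v).slice t = 0 := by
  have h : v.slice t = 0 := funext fun x => hv x.1 (atTime t x.2) ht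
  rw [CChain.slice_d, h]
  exact CChain.co_injective fun c => by
    have h0 : ∀ k, (0 : CChain L 0 k).co c = 0 := fun k => map_zero Chain.toCochain
    rw [CChain.co_d, h0, h0, map_zero]

/-- The substitution `a ↦ a + dv` in the sum over histories. -/
lemma pathSum_gauge (b : CChain L T 2) (q : CChain L T 1) (ψ : Config L → ℂ) (g : Config L)
    {v : CChain L T 0} (hv : v ∈ interior L T) :
    pathSum b q ψ g = ∑ a : CChain L T 1, if a.slice (Fin.last T) = g ∧ d a = b then
      sgn (v ⬝ᵥ dT q + gaugeVar a v) * (sgn (q ⬝ᵥ a + action a) * ψ (a.slice 0)) else 0 := by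
  rw [pathSum, ← Equiv.sum_comp (Equiv.addRight (d v))]
  refine Finset.sum_congr rfl fun a _ => ?_
  have hs : ∀ t : Fin (T + 1), ((t : ℕ) = 0 ∨ (t : ℕ) = T) → (a + d v).slice t = a.slice t := by
    intro t ht
    change a.slice t + (d v).slice t = a.slice t
    rw [slice_d_eq_zero hv ht, add_zero]
  rw [Equiv.coe_addRight, hs _ (.inr rfl), hs _ (.inl rfl), d_add, d_d, add_zero, ← mul_assoc,
    ← sgn_add, dotProduct_dT, gaugeVar, dotProduct_add, dotProduct_comm (d v)]
  congr 3
  ring_nf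

lemma pathSum_eq_zero_of_d_ne_zero {b : CChain L T 2} (hb : d b ≠ 0) (q : CChain L T 1)
    (ψ : Config L → ℂ) (g : Config L) : pathSum b q ψ g = 0 :=
  Finset.sum_eq_zero fun a _ => if_neg fun h => hb (by rw [← h.2, d_d])

/-- If the gauge variance of all histories with flux `b` is different from the charge of `v`, the
amplitudes of `a` and `a + dv` cancel. -/
lemma pathSum_eq_zero_of_gaugeVar_ne {b : CChain L T 2} {q : CChain L T 1} {v : CChain L T 0}
    (hv : v ∈ interior L T) (h : ∀ a : CChain L T 1, d a = b → v ⬝ᵥ dT q ≠ gaugeVar a v)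
    (ψ : Config L → ℂ) (g : Config L) : pathSum b q ψ g = 0 := by
  have hneg : pathSum b q ψ g = -pathSum b q ψ g := by
    conv_lhs => rw [pathSum_gauge b q ψ g hv]
    rw [pathSum, ← Finset.sum_neg_distrib]
    refine Finset.sum_congr rfl fun a _ => ?_
    split_ifs with ha
    · have h1 : sgn (v ⬝ᵥ dT q + gaugeVar a v) = -1 :=
        if_neg fun h0 => h a ha.2 (CharTwo.add_eq_zero.1 h0)
      rw [h1, neg_one_mul]
    · rw [neg_zero]
  exact self_eq_neg.1 hneg

/-- The sign of a twisted equivalence. -/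
def equivSign (b : CChain L T 2) (q : CChain L T 1) (γ : CChain L T 2) (v : CChain L T 0) :
    ZMod 2 :=
  b ⬝ᵥ γ + v ⬝ᵥ dT q + gaugeOffset b v

lemma pathSum_add (b : CChain L T 2) (q : CChain L T 1) (γ : CChain L T 2) {v : CChain L T 0}
    (hv : v ∈ interior L T) (ψ : Config L → ℂ) (g : Config L) :
    pathSum b (q + (dT γ + twist b v)) ψ g = sgn (equivSign b q γ v) * pathSum b q ψ g := by
  rw [pathSum_gauge b q ψ g hv, pathSum, Finset.mul_sum]
  refine Finset.sum_congr rfl fun a _ => ?_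
  split_ifs with ha
  · rw [← mul_assoc, ← mul_assoc, ← sgn_add, ← sgn_add, gaugeVar_eq a hv, ha.2, add_dotProduct,
      add_dotProduct, dotProduct_comm (dT γ), dotProduct_dT, ha.2, dotProduct_comm (twist b v),
      dotProduct_twist, equivSign]
    congr 2
    linear_combination (-(v ⬝ᵥ dT q) - gaugeOffset b v) *
      (CharTwo.two_eq_zero : (2 : ZMod 2) = 0)
  · rw [mul_zero]

lemma finalZ_apply (q : CChain L T 1) (ψ : Config L → ℂ) (g : Config L) :
    finalZ q ψ g = sgn (q.slice (Fin.last T) ⬝ᵥ g) * ψ g := by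
  rw [finalZ, diagOp_apply, dotProduct, sgn_sum]
  rfl

lemma circuit_add [NeZero T] {b : CChain L T 2}
    (hb : ∀ (c : Color) (x : Cell L T 3), x.time + 1 = T → d b (c, x) = 0) (q : CChain L T 1)
    (γ : CChain L T 2) {v : CChain L T 0} (hv : v ∈ interior L T) :
    circuit b (q + (dT γ + twist b v)) =
      sgn (equivSign b q γ v) • (finalZ (dT γ + twist b v) * circuit b q) := by
  refine LinearMap.ext fun ψ => funext fun g => ?_
  have hs : ∀ x y : CChain L T 1, (x + y).slice (Fin.last T) =
      x.slice (Fin.last T) + y.slice (Fin.last T) := fun _ _ => rfl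
  rw [circuit_apply hb, pathSum_add b q γ hv, LinearMap.smul_apply, Pi.smul_apply,
    Module.End.mul_apply, finalZ_apply, circuit_apply hb, hs, add_dotProduct, sgn_add,
    smul_eq_mul]
  ring

lemma finalZ_eq_one {q : CChain L T 1} (hq : ∀ c e, q (c, atTime (Fin.last T) e) = 0) :
    finalZ q = 1 := by
  refine LinearMap.ext fun ψ => funext fun g => ?_
  have h : q.slice (Fin.last T) = 0 := funext fun x => hq x.1 x.2
  rw [finalZ_apply, h, zero_dotProduct, sgn_zero, one_mul]
  rfl

/-! ### Constraint matrices -/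

namespace IsConstraintMatrix

variable {I : Type} [Fintype I] {b : CChain L T 2}
  {K : Matrix I (Color × Cell L T 0) (ZMod 2)} (hK : IsConstraintMatrix b K)

include hK

lemma mem (y : I → ZMod 2) : Kᵀ *ᵥ y ∈ interior L T ∧ M b (Kᵀ *ᵥ y) = 0 := by
  have h : Kᵀ *ᵥ y ∈ {v | v ∈ interior L T ∧ M b v = 0} := hK.2 ▸ ⟨y, rfl⟩
  exact h

lemma gaugeVar_eq [DecidableEq I] {a : CChain L T 1} (ha : d a = b) (y : I → ZMod 2) :
    gaugeVar a (Kᵀ *ᵥ y) = kappa a K ⬝ᵥ y := by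
  rw [dotProduct_comm]
  refine (dotProduct_single_apply (AddMonoidHom.mk' (fun y => gaugeVar a (Kᵀ *ᵥ y))
    fun y z => ?_) y).symm
  rw [Matrix.mulVec_add, gaugeVar_add (hK.mem y).1 (ha ▸ (hK.mem y).2)]

end IsConstraintMatrix

end TQD

end

theorem mainTheorem3 (L T : ℕ) [NeZero L] [NeZero T]
    (b : TQD.CChain L T 2) (q : TQD.CChain L T 1)
    -- the circuit does not read `b` on the faces at time `T`: these values are the outgoing flux
    (hb : ∀ (c : TQD.Color) (x : TQD.Cell L T 3), x.time + 1 = T → TQD.d b (c, x) = 0) :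
    -- flux constraint
    (TQD.d b ≠ 0 → TQD.circuit b q = 0) ∧
    -- the form `M^b` is the second-order gauge variance
    (∀ (a : TQD.CChain L T 1) (w v : TQD.CChain L T 0), TQD.d a = b → v ∈ TQD.interior L T →
      TQD.gaugeVar (a + TQD.d w) v - TQD.gaugeVar a v = w ⬝ᵥ TQD.M b v) ∧
    -- `M^b` is symmetric
    (TQD.d b = 0 → ∀ w ∈ TQD.interior L T, ∀ v ∈ TQD.interior L T,
      w ⬝ᵥ TQD.M b v = v ⬝ᵥ TQD.M b w) ∧
    -- `M̃^b` is given by the cup product formula, and `dᵀ M̃^b = M^b`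
    (∀ (x : TQD.CChain L T 1) (v : TQD.CChain L T 0),
      x ⬝ᵥ TQD.twist b v = TQD.twistForm b x v) ∧
    (∀ v : TQD.CChain L T 0, TQD.dT (TQD.twist b v) = TQD.M b v) ∧
    -- twisted constraints
    (TQD.NoNoncontractibleLoop b → ∀ (I : Type) [Fintype I] [DecidableEq I]
      (K : Matrix I (TQD.Color × TQD.Cell L T 0) (ZMod 2)), TQD.IsConstraintMatrix b K →
        (∀ a a' : TQD.CChain L T 1, TQD.d a = b → TQD.d a' = b →
          TQD.kappa a K = TQD.kappa a' K) ∧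
        (∀ a : TQD.CChain L T 1, TQD.d a = b →
          (∀ y : I → ZMod 2, TQD.gaugeVar a (Kᵀ *ᵥ y) = TQD.kappa a K ⬝ᵥ y) ∧
          (K *ᵥ TQD.dT q ≠ TQD.kappa a K → TQD.circuit b q = 0))) ∧
    -- twisted equivalences
    (∀ (γ : TQD.CChain L T 2), ∀ v ∈ TQD.interior L T, ∃ s : ℂ, (s = 1 ∨ s = -1) ∧
      ((∀ (c : TQD.Color) (e : TQD.Cell L 0 1),
          (TQD.dT γ + TQD.twist b v) (c, TQD.atTime (Fin.last T) e) = 0) →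
        TQD.circuit b (q + TQD.dT γ + TQD.twist b v) = s • TQD.circuit b q) ∧
      TQD.circuit b (q + TQD.dT γ + TQD.twist b v) =
        s • (TQD.finalZ (TQD.dT γ + TQD.twist b v) * TQD.circuit b q)) := by
  have hzero : (∀ ψ g, TQD.pathSum b q ψ g = 0) → TQD.circuit b q = 0 := fun h =>
    LinearMap.ext fun ψ => funext fun g => by
      rw [TQD.circuit_apply hb, h, mul_zero, mul_zero]
      rfl
  refine ⟨fun h => hzero (TQD.pathSum_eq_zero_of_d_ne_zero h q), ?_, ?_, TQD.dotProduct_twist b,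
    TQD.dT_twist b, ?_, ?_⟩
  · rintro a w v rfl hv
    exact TQD.gaugeVar_add_d_sub a w hv
  · intro h w hw v _
    exact TQD.M_symm h hw
  · intro hloop I _ _ K hK
    have hκ : ∀ (a a' : TQD.CChain L T 1), TQD.d a = b → TQD.d a' = b → ∀ y : I → ZMod 2,
        TQD.gaugeVar a (Kᵀ *ᵥ y) = TQD.gaugeVar a' (Kᵀ *ᵥ y) := fun a a' ha ha' y =>
      hloop.gaugeVar_eq ha ha' (hK.mem y).1 (hK.mem y).2
    refine ⟨fun a a' ha ha' => funext fun i => hκ a a' ha ha' _, fun a ha =>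
      ⟨hK.gaugeVar_eq ha, fun hne => ?_⟩⟩
    obtain ⟨i, hi⟩ := Function.ne_iff.1 hne
    refine hzero (TQD.pathSum_eq_zero_of_gaugeVar_ne (hK.mem (Pi.single i 1)).1
      fun a' ha' h => hi ?_)
    rw [← hκ a a' ha ha', Matrix.mulVec_transpose, ← Matrix.dotProduct_mulVec,
      single_one_dotProduct] at h
    rw [h, TQD.kappa, Matrix.mulVec_transpose]
  · intro γ v hv
    rw [add_assoc q]
    refine ⟨_, TQD.sgn_eq (TQD.equivSign b q γ v), fun h => ?_, TQD.circuit_add hb q γ hv⟩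
    rw [TQD.circuit_add hb q γ hv, TQD.finalZ_eq_one h, one_mul]
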